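/- **Conventions.** A (finite, 3-term) chain complex $X$ consists of finite sets $X(0),X(1),X(2)$ and linear maps $\partial_1:\mathbb F_2^{X(1)}\to\mathbb F_2^{X(0)}$, $\partial_2:\mathbb F_2^{X(2)}\to\mathbb F_2^{X(1)}$ with $\partial_1\partial_2=0$; put $\delta_0=\partial_1^T$, $\delta_1=\partial_2^T$, $B_1=\operatorname{im}\partial_2$, $B^1=\operatorname{im}\delta_0$, $Z^1=\ker\delta_1$, $H^1=Z^1/B^1$. Complexes are assumed non-degenerate: every row and column of the matrices $\partial_1,\partial_2$ contains a $1$. The maximum (minimum) degree of $X$ is the maximum (minimum) Hamming weight of the rows and columns of $\partial_1$ and $\partial_2$; $|f|$ is Hamming weight and $d(f,B_1)=\min_{b\in B_1}|f+b|$. $X$ has $\mu$-co-systolic distance if $|f|>\mu|X(1)|$ for all $f\in Z^1\setminus B^1$, and is a $(\rho_1,\rho_2)$-small-set boundary expander if $|\partial_1 f|\ge\rho_2\, d(f,B_1)$ for all $f\in\mathbb F_2^{X(1)}\setminus B_1$ with $|f|\le\rho_1|X(1)|$. A family $(X_i)_{i\in\mathbb N}$ is explicit if one deterministic algorithm computes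 $X_i$ from $i$ in time polynomial in $|X_i(0)\cup X_i(1)\cup X_i(2)|$. A MAX-$3$-XOR instance on $n$ variables is a list of $m$ constraints $\sum_{j\in T_l}x_j=z_l$ over $\mathbb F_2$ with $T_l\subseteq[n]$, $|T_l|\le 3$; it is a $3$-XOR instance if $|T_l|=3$ for all $l$. It is at most $r$-satisfiable if no assignment satisfies more than an $r$ fraction of the constraints. A family of instances $(\mathcal I_i)_{i\in\mathbb N}$ is explicit if one deterministic algorithm computes $\mathcal I_i$ from $i$ in time polynomial in its number of variables. The round-$t$ SoS relaxation, defined when $|T_l|\le t$ for all $l$, is to maximize $$\frac12+\frac1{2m}\sum_{l=1}^m(-1)^{z_l}\langle v_{T_l},v_\emptyset\rangle$$ over real vectors $v_S$ ($S\subseteq[n]$, $|S|\le t$) with $\|v_S\|_2=1$ and $\langle v_{S_1},v_{S_2}\rangle=\langle v_{S_3},v_{S_4}\rangle$ whenever $S_1\oplus S_2=S_3\oplus S_4$. The instance cannot be refuted by $t$ levels of SoS if this maximum is $1$ (at levels $t$ at which the relaxation is not defined there is nothing to refute it); for real $s$, "$s$ levels" means every integer level $0\le t\le s$. **Theorem.**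 Let $k\in\mathbb N$ and $\mu,\rho_1,\rho_2\in(0,1)$. There are constants $\mu_1,\mu_2\in(0,1)$ and $C\in\mathbb N$, depending only on $k,\mu,\rho_1,\rho_2$, such that the following holds. Let $(X_i)_{i\in\mathbb N}$ be an explicit family of non-degenerate chain complexes of maximum degree at most $k$ such that for every $i$: 1. $H^1(X_i)$ is non-trivial, 2. $X_i$ has $\mu$-co-systolic distance, 3. $X_i$ is a $(\rho_1,\rho_2)$-small-set boundary expander. Then there is an explicit family of MAX-$3$-XOR instances $(\mathcal I_i)_{i\in\mathbb N}$, with $\mathcal I_i$ on $n_i$ variables where $|X_i(0)|\le n_i\le C\,|X_i(0)|$, such that for every $i$: 1. $\mathcal I_i$ is at most $(1-\mu_1)$-satisfiable, 2. $\mathcal I_i$ cannot be refuted by $\mu_2 n_i$ levels of the SoS hierarchy. Moreover, whenever $X_i$ has minimum degree at least $3$, $\mathcal I_i$ is an instance of $3$-XOR. -/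

import Mathlib

/-! ### Three-term chain complexes over `𝔽₂` -/

/-- A finite three-term chain complex
`𝔽₂^{X(0)} ← 𝔽₂^{X(1)} ← 𝔽₂^{X(2)}` with `X(j) = {0, …, n_j - 1}`, given by the matrices of its
boundary operators in the standard bases. -/
structure F2Complex where
  n₀ : ℕ
  n₁ : ℕ
  n₂ : ℕ
  bd₁ : Matrix (Fin n₀) (Fin n₁) (ZMod 2)
  bd₂ : Matrix (Fin n₁) (Fin n₂) (ZMod 2)
  bd₁_mul_bd₂ : bd₁ * bd₂ = 0

namespace F2Complex

/-- The boundary operator `∂₁`. -/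
def boundary₁ (X : F2Complex) : (Fin X.n₁ → ZMod 2) →ₗ[ZMod 2] (Fin X.n₀ → ZMod 2) :=
  X.bd₁.mulVecLin

/-- The boundary operator `∂₂`. -/
def boundary₂ (X : F2Complex) : (Fin X.n₂ → ZMod 2) →ₗ[ZMod 2] (Fin X.n₁ → ZMod 2) :=
  X.bd₂.mulVecLin

/-- The co-boundary operator `δ₀ = ∂₁ᵀ`. -/
def coboundary₀ (X : F2Complex) : (Fin X.n₀ → ZMod 2) →ₗ[ZMod 2] (Fin X.n₁ → ZMod 2) :=
  X.bd₁.transpose.mulVecLin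

/-- The co-boundary operator `δ₁ = ∂₂ᵀ`. -/
def coboundary₁ (X : F2Complex) : (Fin X.n₁ → ZMod 2) →ₗ[ZMod 2] (Fin X.n₂ → ZMod 2) :=
  X.bd₂.transpose.mulVecLin

/-- The space `B₁ = im ∂₂` of boundaries. -/
def boundaries (X : F2Complex) : Submodule (ZMod 2) (Fin X.n₁ → ZMod 2) :=
  LinearMap.range X.boundary₂

/-- The space `B¹ = im δ₀` of co-boundaries. -/
def coboundaries (X : F2Complex) : Submodule (ZMod 2) (Fin X.n₁ → ZMod 2) :=
  LinearMap.range X.coboundary₀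

/-- The space `Z¹ = ker δ₁` of co-cycles. -/
def cocycles (X : F2Complex) : Submodule (ZMod 2) (Fin X.n₁ → ZMod 2) :=
  LinearMap.ker X.coboundary₁

/-- The first cohomology `H¹ = Z¹ / B¹`. -/
abbrev Cohomology (X : F2Complex) : Type :=
  X.cocycles ⧸ X.coboundaries.submoduleOf X.cocycles

/-- Every row and every column of `∂₁` and of `∂₂` has Hamming weight at most `k`. -/
def MaxDegreeLE (X : F2Complex) (k : ℕ) : Prop :=
  (∀ x, hammingNorm (fun y => X.bd₁ x y) ≤ k) ∧ (∀ y, hammingNorm (fun x => X.bd₁ x y) ≤ k) ∧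
  (∀ y, hammingNorm (fun z => X.bd₂ y z) ≤ k) ∧ (∀ z, hammingNorm (fun y => X.bd₂ y z) ≤ k)

/-- Every row and every column of `∂₁` and of `∂₂` has Hamming weight at least `d`. -/
def MinDegreeGE (X : F2Complex) (d : ℕ) : Prop :=
  (∀ x, d ≤ hammingNorm (fun y => X.bd₁ x y)) ∧ (∀ y, d ≤ hammingNorm (fun x => X.bd₁ x y)) ∧
  (∀ y, d ≤ hammingNorm (fun z => X.bd₂ y z)) ∧ (∀ z, d ≤ hammingNorm (fun y => X.bd₂ y z))

/-- Every row and every column of `∂₁` and of `∂₂` contains a `1`. -/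
def Nondegenerate (X : F2Complex) : Prop := X.MinDegreeGE 1

/-- Co-systolic distance `μ`: co-cycles that are not co-boundaries have weight above `μ |X(1)|`. -/
def HasCosystolicDistance (X : F2Complex) (μ : ℝ) : Prop :=
  ∀ f ∈ X.cocycles, f ∉ X.coboundaries → μ * (X.n₁ : ℝ) < (hammingNorm f : ℝ)

/-- The distance `d(f, B₁) = min_{b ∈ B₁} |f + b|`. -/
noncomputable def distBoundaries (X : F2Complex) (f : Fin X.n₁ → ZMod 2) : ℕ :=
  ⨅ b : X.boundaries, hammingNorm (f + (b : Fin X.n₁ → ZMod 2))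

/-- `(ρ₁, ρ₂)`-small-set boundary expansion: `|∂₁ f| ≥ ρ₂ d(f, B₁)` for all `f ∉ B₁` with
`|f| ≤ ρ₁ |X(1)|`. -/
def SmallSetBoundaryExpander (X : F2Complex) (ρ₁ ρ₂ : ℝ) : Prop :=
  ∀ f : Fin X.n₁ → ZMod 2, f ∉ X.boundaries → (hammingNorm f : ℝ) ≤ ρ₁ * (X.n₁ : ℝ) →
    ρ₂ * (X.distBoundaries f : ℝ) ≤ (hammingNorm (X.boundary₁ f) : ℝ)

end F2Complex

/-! ### XOR instances and the Sum-of-Squares relaxation -/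

/-- A system of `m` XOR constraints on the variables `x_0, …, x_{n-1}`; the `i`th constraint is
`∑_{j ∈ T i} x_j = z i` over `𝔽₂`. -/
structure XorInstance where
  n : ℕ
  m : ℕ
  T : Fin m → Finset (Fin n)
  z : Fin m → ZMod 2

namespace XorInstance

/-- MAX-`k`-XOR: every constraint involves at most `k` variables. -/
def IsMaxXor (I : XorInstance) (k : ℕ) : Prop := ∀ i, (I.T i).card ≤ k

/-- `k`-XOR: every constraint involves exactly `k` variables. -/
def IsExactXor (I : XorInstance) (k : ℕ) : Prop := ∀ i, (I.T i).card = k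

/-- The number of constraints satisfied by the assignment `f`. -/
def numSat (I : XorInstance) (f : Fin I.n → ZMod 2) : ℕ :=
  (Finset.univ.filter fun i : Fin I.m => ∑ j ∈ I.T i, f j = I.z i).card

/-- No assignment satisfies more than an `r` fraction of the constraints. -/
def AtMostSatisfiable (I : XorInstance) (r : ℝ) : Prop :=
  ∀ f : Fin I.n → ZMod 2, (I.numSat f : ℝ) ≤ r * (I.m : ℝ)

/-- Feasible points of the round-`t` relaxation: vectors `v_S`, for sets `S` of at most `t`
variables, of norm one and such that `⟪v_{S₁}, v_{S₂}⟫` depends only on `S₁ ⊕ S₂`.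
(The values of `v` at larger sets are ignored.) -/
def SoSFeasible {n d : ℕ} (t : ℕ) (v : Finset (Fin n) → EuclideanSpace ℝ (Fin d)) : Prop :=
  (∀ S₁ S₂ S₃ S₄ : Finset (Fin n), S₁.card ≤ t → S₂.card ≤ t → S₃.card ≤ t → S₄.card ≤ t →
    symmDiff S₁ S₂ = symmDiff S₃ S₄ → inner ℝ (v S₁) (v S₂) = inner ℝ (v S₃) (v S₄)) ∧
  (∀ S : Finset (Fin n), S.card ≤ t → ‖v S‖ = 1)

/-- The objective `1/2 + (1/2m) ∑ᵢ (-1)^{zᵢ} ⟪v_{Tᵢ}, v_∅⟫`. -/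
noncomputable def sosObjective (I : XorInstance) {d : ℕ}
    (v : Finset (Fin I.n) → EuclideanSpace ℝ (Fin d)) : ℝ :=
  1 / 2 + 1 / (2 * (I.m : ℝ)) * ∑ i, (-1 : ℝ) ^ (I.z i).val * inner ℝ (v (I.T i)) (v ∅)

/-- The round-`t` relaxation has (attained) maximum `r`. -/
def HasSoSValue (I : XorInstance) (t : ℕ) (r : ℝ) : Prop :=
  IsGreatest {s : ℝ | ∃ (d : ℕ) (v : Finset (Fin I.n) → EuclideanSpace ℝ (Fin d)),
    SoSFeasible t v ∧ s = I.sosObjective v} r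

/-- `I` is not refuted by `t` levels: the round-`t` relaxation has value `1`. The relaxation of `I`
exists only when its objective involves no vector `v_S` with `|S| > t`, that is, when each
constraint has at most `t` variables; at lower levels there is nothing that could refute `I`. -/
def NotRefuted (I : XorInstance) (t : ℕ) : Prop :=
  I.IsMaxXor t → I.HasSoSValue t 1

end XorInstance

/-! ### Deterministic algorithms and their running time

Algorithms are programs of the WHILE language over binary trees, written with a single
variable. The time charged to an execution is, up to an additive constant per executed instruction,
the total number of nodes of all trees that it writes, so that this model and Turing machines
simulate each other with an overhead polynomial in the time and the input length. -/

/-- Binary trees, the data of the WHILE language. -/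
inductive BinData : Type
  | nil : BinData
  | cons : BinData → BinData → BinData

namespace BinData

/-- The number of nodes, leaves included. -/
def size : BinData → ℕ
  | nil => 1
  | cons a b => a.size + b.size + 1

/-- Left subtree (`nil` for a leaf). -/
def fst : BinData → BinData
  | nil => nil
  | cons a _ => a

/-- Right subtree (`nil` for a leaf). -/
def snd : BinData → BinData
  | nil => nil
  | cons _ b => b

/-- A list of trees, as a tree. -/
def ofList : List BinData → BinData
  | [] => nil
  | a :: l => cons a (ofList l)

/-- A bit, as a tree. -/
def ofBool : Bool → BinData
  | false => nil
  | true => cons nil nil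

/-- A natural number in binary notation (least significant bit first). -/
def ofNatBinary (n : ℕ) : BinData := ofList (n.bits.map ofBool)

/-- A natural number in unary notation. -/
def ofNatUnary (n : ℕ) : BinData := ofList (List.replicate n nil)

/-- A vector over `𝔽₂`, as the list of its entries. -/
def ofVec {a : ℕ} (f : Fin a → ZMod 2) : BinData :=
  ofList (List.ofFn fun x => ofBool (decide (f x = 1)))

/-- A matrix over `𝔽₂`, as the list of its rows. -/
def ofMatrix {a b : ℕ} (M : Matrix (Fin a) (Fin b) (ZMod 2)) : BinData :=
  ofList (List.ofFn fun x => ofVec (M x))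

/-- A chain complex is written as the three sizes and the two boundary matrices. -/
def ofComplex (X : F2Complex) : BinData :=
  ofList [ofNatUnary X.n₀, ofNatUnary X.n₁, ofNatUnary X.n₂, ofMatrix X.bd₁, ofMatrix X.bd₂]

/-- An XOR instance is written as the number of variables and the list of its constraints, each of
which is the incidence vector of its variables with its right-hand side. -/
def ofXor (I : XorInstance) : BinData :=
  cons (ofNatUnary I.n)
    (ofList (List.ofFn fun i =>
      cons (ofVec fun j => if j ∈ I.T i then 1 else 0) (ofBool (decide (I.z i = 1)))))

end BinData

/-- Programs. Each maps the current tree to a new one: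
`nil`, `id`, `fst`, `snd` are the basic operations, `pair p q` joins the results of `p` and `q`,
`comp p q` runs `q` and then `p`, `ite c p q` runs `p` if the result of `c` is not `nil` and `q`
otherwise, and `loop c p` replaces the current tree by the result of `p` as long as the result of
`c` is not `nil`. -/
inductive WhileProg : Type
  | nil : WhileProg
  | id : WhileProg
  | fst : WhileProg
  | snd : WhileProg
  | pair : WhileProg → WhileProg → WhileProg
  | comp : WhileProg → WhileProg → WhileProg
  | ite : WhileProg → WhileProg → WhileProg → WhileProg
  | loop : WhileProg → WhileProg → WhileProg

/-- `WhileProg.Runs p x y c`: on input `x` the program `p` halts with output `y` in time `c`. -/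
inductive WhileProg.Runs : WhileProg → BinData → BinData → ℕ → Prop
  | nil (x : BinData) : Runs .nil x .nil 1
  | id (x : BinData) : Runs .id x x x.size
  | fst (x : BinData) : Runs .fst x x.fst x.fst.size
  | snd (x : BinData) : Runs .snd x x.snd x.snd.size
  | pair {p q : WhileProg} {x y z : BinData} {a b : ℕ} :
      Runs p x y a → Runs q x z b →
      Runs (.pair p q) x (.cons y z) (a + b + (BinData.cons y z).size)
  | comp {p q : WhileProg} {x y z : BinData} {a b : ℕ} :
      Runs q x y a → Runs p y z b → Runs (.comp p q) x z (a + b + 1)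
  | ite_true {c p q : WhileProg} {x u v y : BinData} {a b : ℕ} :
      Runs c x (.cons u v) a → Runs p x y b → Runs (.ite c p q) x y (a + b + 1)
  | ite_false {c p q : WhileProg} {x y : BinData} {a b : ℕ} :
      Runs c x .nil a → Runs q x y b → Runs (.ite c p q) x y (a + b + 1)
  | loop_stop {c p : WhileProg} {x : BinData} {a : ℕ} :
      Runs c x .nil a → Runs (.loop c p) x x (a + x.size)
  | loop_step {c p : WhileProg} {x u v y z : BinData} {a b d : ℕ} :
      Runs c x (.cons u v) a → Runs p x y b → Runs (.loop c p) y z d →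
      Runs (.loop c p) x z (a + b + d + 1)

/-- A family of complexes is explicit: one algorithm computes `X_i` from `i` (in binary) in time
polynomial in `|X_i(0) ∪ X_i(1) ∪ X_i(2)|`. -/
def ExplicitComplexes (X : ℕ → F2Complex) : Prop :=
  ∃ (p : WhileProg) (P : Polynomial ℕ), ∀ i : ℕ, ∃ c : ℕ,
    c ≤ P.eval ((X i).n₀ + (X i).n₁ + (X i).n₂) ∧
    p.Runs (BinData.ofNatBinary i) (BinData.ofComplex (X i)) c

/-- A family of XOR instances is explicit: one algorithm computes `I_i` from `i` (in binary) in time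
polynomial in the number of variables of `I_i`. -/
def ExplicitInstances (I : ℕ → XorInstance) : Prop :=
  ∃ (p : WhileProg) (P : Polynomial ℕ), ∀ i : ℕ, ∃ c : ℕ,
    c ≤ P.eval (I i).n ∧ p.Runs (BinData.ofNatBinary i) (BinData.ofXor (I i)) c

/-! ### Polynomial-time functions on encoded data -/

theorem Polynomial.eval_nat_mono (P : Polynomial ℕ) {a b : ℕ} (h : a ≤ b) :
    P.eval a ≤ P.eval b := by
  rw [Polynomial.eval_eq_sum, Polynomial.eval_eq_sum]
  exact Finset.sum_le_sum fun i _ => Nat.mul_le_mul_left _ (Nat.pow_le_pow_left h i)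

theorem BinData.one_le_size (x : BinData) : 1 ≤ x.size := by
  cases x <;> simp [BinData.size]

/-- The running time bounds the size of the output. -/
theorem WhileProg.Runs.size_le {p : WhileProg} {x y : BinData} {c : ℕ} (h : p.Runs x y c) :
    y.size ≤ c := by
  induction h <;> (try simp only [BinData.size] at *) <;> omega

/-- Types whose elements are written as binary trees. -/
class TreeCode (α : Type) where
  code : α → BinData

open TreeCode (code)

/-- The number of nodes of the tree of `a`. -/
def codeSize {α : Type} [TreeCode α] (a : α) : ℕ := (code a).size

instance : TreeCode Unit := ⟨fun _ => .nil⟩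
instance : TreeCode Bool := ⟨BinData.ofBool⟩
instance {α β : Type} [TreeCode α] [TreeCode β] : TreeCode (α × β) :=
  ⟨fun a => .cons (code a.1) (code a.2)⟩
instance {α : Type} [TreeCode α] : TreeCode (List α) := ⟨fun l => BinData.ofList (l.map code)⟩

/-- Functions computed by a program in time polynomial in the size of the input tree. -/
def PolyTime {α β : Type} [TreeCode α] [TreeCode β] (f : α → β) : Prop :=
  ∃ (p : WhileProg) (P : Polynomial ℕ), ∀ a, ∃ c, c ≤ P.eval (codeSize a) ∧
    p.Runs (code a) (code (f a)) c

section CodeSize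

variable {α β : Type} [TreeCode α] [TreeCode β]

theorem one_le_codeSize (a : α) : 1 ≤ codeSize a := BinData.one_le_size _

@[simp] theorem code_nil : code ([] : List α) = .nil := rfl
@[simp] theorem code_cons (a : α) (l : List α) : code (a :: l) = .cons (code a) (code l) := rfl
@[simp] theorem code_pair (a : α) (b : β) : code (a, b) = .cons (code a) (code b) := rfl
@[simp] theorem code_true : code true = .cons .nil .nil := rfl
@[simp] theorem code_false : code false = .nil := rfl

@[simp] theorem codeSize_nil : codeSize ([] : List α) = 1 := rfl
@[simp] theorem codeSize_cons (a : α) (l : List α) :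
    codeSize (a :: l) = codeSize a + codeSize l + 1 := rfl
@[simp] theorem codeSize_pair (a : α) (b : β) :
    codeSize (a, b) = codeSize a + codeSize b + 1 := rfl

theorem codeSize_bool_le (b : Bool) : codeSize b ≤ 3 := by cases b <;> decide

theorem codeSize_le_of_mem {a : α} {l : List α} (h : a ∈ l) : codeSize a ≤ codeSize l := by
  induction l with
  | nil => simp at h
  | cons b l ih =>
    rcases List.mem_cons.1 h with rfl | h
    · simp; omega
    · have := ih h; simp; omega

theorem length_lt_codeSize (l : List α) : l.length < codeSize l := by
  induction l with
  | nil => simp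
  | cons a l ih => simp; omega

theorem codeSize_append (l₁ l₂ : List α) :
    codeSize (l₁ ++ l₂) + 1 = codeSize l₁ + codeSize l₂ := by
  induction l₁ with
  | nil => simp; omega
  | cons a l ih => simp; omega

theorem codeSize_reverse (l : List α) : codeSize l.reverse = codeSize l := by
  induction l with
  | nil => simp
  | cons a l ih => have := codeSize_append l.reverse [a]; simp at this ⊢; omega

theorem codeSize_list_le (l : List α) (B : ℕ) (h : ∀ a ∈ l, codeSize a ≤ B) :
    codeSize l ≤ l.length * (B + 1) + 1 := by
  induction l with
  | nil => simp
  | cons a l ih =>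
    have h1 := ih fun b hb => h b (List.mem_cons_of_mem _ hb)
    have h2 := h a List.mem_cons_self
    simp only [codeSize_cons, List.length_cons, Nat.add_mul]
    omega

theorem codeSize_le_of_suffix {l₁ l₂ : List α} (h : l₁ <:+ l₂) : codeSize l₁ ≤ codeSize l₂ := by
  obtain ⟨t, rfl⟩ := h
  have := codeSize_append t l₁
  have := one_le_codeSize t
  omega

end CodeSize

namespace PolyTime

variable {α β γ σ : Type} [TreeCode α] [TreeCode β] [TreeCode γ] [TreeCode σ]

theorem exists_codeSize_le {f : α → β} (hf : PolyTime f) :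
    ∃ P : Polynomial ℕ, ∀ a, codeSize (f a) ≤ P.eval (codeSize a) := by
  obtain ⟨p, P, h⟩ := hf
  refine ⟨P, fun a => ?_⟩
  obtain ⟨c, hc, hr⟩ := h a
  exact hr.size_le.trans hc

protected theorem id : PolyTime fun a : α => a :=
  ⟨.id, .X, fun a => ⟨_, by simp [codeSize], .id _⟩⟩

protected theorem fst : PolyTime fun a : α × β => a.1 :=
  ⟨.fst, .X, fun a => ⟨codeSize a.1, by
    have : codeSize a = codeSize a.1 + codeSize a.2 + 1 := rfl
    simp; omega, .fst _⟩⟩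

protected theorem snd : PolyTime fun a : α × β => a.2 :=
  ⟨.snd, .X, fun a => ⟨codeSize a.2, by
    have : codeSize a = codeSize a.1 + codeSize a.2 + 1 := rfl
    simp; omega, .snd _⟩⟩

theorem pair {f : α → β} {g : α → γ} (hf : PolyTime f) (hg : PolyTime g) :
    PolyTime fun a => (f a, g a) := by
  obtain ⟨p, P, hp⟩ := hf
  obtain ⟨q, Q, hq⟩ := hg
  refine ⟨.pair p q, 2 * P + 2 * Q + 1, fun a => ?_⟩
  obtain ⟨c, hc, hpr⟩ := hp a
  obtain ⟨d, hd, hqr⟩ := hq a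
  refine ⟨_, ?_, .pair hpr hqr⟩
  have := hpr.size_le
  have := hqr.size_le
  simp [BinData.size]
  omega

theorem comp {g : β → γ} {f : α → β} (hg : PolyTime g) (hf : PolyTime f) :
    PolyTime fun a => g (f a) := by
  obtain ⟨p, P, hp⟩ := hf
  obtain ⟨q, Q, hq⟩ := hg
  refine ⟨.comp q p, P + Q.comp P + 1, fun a => ?_⟩
  obtain ⟨c, hc, hpr⟩ := hp a
  obtain ⟨d, hd, hqr⟩ := hq (f a)
  refine ⟨_, ?_, .comp hpr hqr⟩
  have := Q.eval_nat_mono (hpr.size_le.trans hc)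
  simp [codeSize] at *
  omega

theorem exists_prog_const (t : BinData) : ∃ p : WhileProg, ∃ c, ∀ x, p.Runs x t c := by
  induction t with
  | nil => exact ⟨.nil, 1, .nil⟩
  | cons a b iha ihb =>
    obtain ⟨p, c, hp⟩ := iha
    obtain ⟨q, d, hq⟩ := ihb
    exact ⟨.pair p q, _, fun x => .pair (hp x) (hq x)⟩

protected theorem const (b : β) : PolyTime fun _ : α => b := by
  obtain ⟨p, c, h⟩ := exists_prog_const (code b)
  exact ⟨p, .C c, fun a => ⟨c, by simp, h _⟩⟩

theorem cond {c : α → Bool} {f g : α → β} (hc : PolyTime c) (hf : PolyTime f) (hg : PolyTime g) :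
    PolyTime fun a => bif c a then f a else g a := by
  obtain ⟨r, R, hr⟩ := hc
  obtain ⟨p, P, hp⟩ := hf
  obtain ⟨q, Q, hq⟩ := hg
  refine ⟨.ite r p q, R + P + Q + 1, fun a => ?_⟩
  obtain ⟨d, hd, hrr⟩ := hr a
  cases h : c a with
  | true =>
    obtain ⟨e, he, her⟩ := hp a
    rw [h] at hrr
    simp only [h, cond_true]
    exact ⟨_, by simp; omega, .ite_true hrr her⟩
  | false =>
    obtain ⟨e, he, her⟩ := hq a
    rw [h] at hrr
    simp only [h, cond_false]
    exact ⟨_, by simp; omega, .ite_false hrr her⟩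

theorem cons {f : α → β} {g : α → List β} (hf : PolyTime f) (hg : PolyTime g) :
    PolyTime fun a => f a :: g a := hf.pair hg

theorem listCases {l : α → List γ} {f : α → β} {g : α × γ × List γ → β} (hl : PolyTime l)
    (hf : PolyTime f) (hg : PolyTime g) :
    PolyTime fun a => (match l a with | [] => f a | b :: t => g (a, b, t)) := by
  obtain ⟨r, R, hr⟩ := hl
  obtain ⟨p, P, hp⟩ := hf
  obtain ⟨q, Q, hq⟩ := hg
  refine ⟨.ite r (.comp q (.pair .id r)) p,
    R + P + (.X + R + (.X + R + 1) + Q.comp (.X + R + 1) + 1) + 1, fun a => ?_⟩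
  obtain ⟨d, hd, hrr⟩ := hr a
  have hs := hrr.size_le
  cases h : l a with
  | nil =>
    obtain ⟨e, he, her⟩ := hp a
    rw [h] at hrr
    simp only [h]
    exact ⟨_, by simp; omega, .ite_false hrr her⟩
  | cons b t =>
    obtain ⟨e, he, her⟩ := hq (a, b, t)
    rw [h] at hrr
    simp only [h]
    refine ⟨_, ?_, .ite_true hrr (.comp (.pair (.id _) hrr) her)⟩
    have hx : codeSize (a, b, t) ≤ (Polynomial.X + R + 1).eval (codeSize a) := by
      rw [h] at hs
      simp [codeSize, BinData.size] at hs hd ⊢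
      omega
    have := Q.eval_nat_mono hx
    rw [h] at hs
    simp [codeSize, BinData.size] at hs hd he this ⊢
    omega

end PolyTime

/-- Execution of a loop that consumes a list. -/
theorem WhileProg.Runs.loop_list {σ β : Type} [TreeCode σ] [TreeCode β] {c p : WhileProg}
    {step : σ → β → σ} {K : ℕ} (l : List β) (s : σ)
    (hc : ∀ l₁ l₂, l₁ ++ l₂ = l → ∃ d ≤ K, c.Runs (code (l₁.foldl step s, l₂)) (code l₂) d)
    (hp : ∀ l₁ b l₂, l₁ ++ b :: l₂ = l → ∃ d ≤ K,
      p.Runs (code (l₁.foldl step s, b :: l₂)) (code (step (l₁.foldl step s) b, l₂)) d)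
    (hK : codeSize (l.foldl step s, ([] : List β)) ≤ K) :
    ∃ d ≤ (l.length + 1) * (2 * K + 1),
      (WhileProg.loop c p).Runs (code (s, l)) (code (l.foldl step s, ([] : List β))) d := by
  induction l generalizing s with
  | nil =>
    obtain ⟨d, hd, hr⟩ := hc [] [] rfl
    refine ⟨_, ?_, WhileProg.Runs.loop_stop hr⟩
    simp only [List.foldl_nil, List.length_nil] at hK ⊢
    unfold codeSize at hK
    omega
  | cons b l ih =>
    obtain ⟨d, hd, hr⟩ := hc [] (b :: l) rfl
    obtain ⟨e, he, her⟩ := hp [] b l rfl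
    obtain ⟨f, hf, hfr⟩ := ih (step s b)
      (fun l₁ l₂ h => hc (b :: l₁) l₂ (by simp [h]))
      (fun l₁ b' l₂ h => hp (b :: l₁) b' l₂ (by simp [h])) hK
    refine ⟨_, ?_, .loop_step hr her hfr⟩
    simp only [List.length_cons]
    nlinarith

namespace PolyTime

variable {α β γ σ : Type} [TreeCode α] [TreeCode β] [TreeCode γ] [TreeCode σ]

theorem foldl {l : α → List β} {init : α → σ} {step : α → σ → β → σ}
    (hl : PolyTime l) (hi : PolyTime init)
    (hs : PolyTime fun p : α × σ × β => step p.1 p.2.1 p.2.2) (Q : Polynomial ℕ)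
    (hQ : ∀ a l', l' <+: l a → codeSize (l'.foldl (step a) (init a)) ≤ Q.eval (codeSize a)) :
    PolyTime fun a => (l a).foldl (step a) (init a) := by
  obtain ⟨L, hL⟩ := hl.exists_codeSize_le
  let body : (α × σ) × List β → (α × σ) × List β := fun x =>
    match x.2 with
    | [] => x
    | b :: t => ((x.1.1, step x.1.1 x.1.2 b), t)
  have hbody : PolyTime body := by
    refine listCases (g := fun y : ((α × σ) × List β) × β × List β =>
      ((y.1.1.1, step y.1.1.1 y.1.1.2 y.2.1), y.2.2)) PolyTime.snd PolyTime.id ?_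
    have h1 : PolyTime fun y : ((α × σ) × List β) × β × List β => y.1.1 :=
      PolyTime.fst.comp PolyTime.fst
    exact ((PolyTime.fst.comp h1).pair (hs.comp ((PolyTime.fst.comp h1).pair
      ((PolyTime.snd.comp h1).pair (PolyTime.fst.comp PolyTime.snd))))).pair
      (PolyTime.snd.comp PolyTime.snd)
  have hcond : PolyTime fun x : (α × σ) × List β => x.2 := PolyTime.snd
  have hstart : PolyTime fun a => (((a, init a), l a) : (α × σ) × List β) :=
    (PolyTime.id.pair hi).pair hl
  have hend : PolyTime fun x : (α × σ) × List β => x.1.2 := PolyTime.snd.comp PolyTime.fst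
  suffices hloop : ∃ (q : WhileProg) (R : Polynomial ℕ), ∀ a, ∃ c ≤ R.eval (codeSize a),
      q.Runs (code ((a, init a), l a))
        (code ((a, (l a).foldl (step a) (init a)), ([] : List β))) c by
    obtain ⟨q, R, hq⟩ := hloop
    obtain ⟨p₁, P₁, h₁⟩ := hstart
    obtain ⟨p₂, P₂, h₂⟩ := hend
    refine ⟨.comp p₂ (.comp q p₁), P₁ + R + P₂.comp R + 2, fun a => ?_⟩
    obtain ⟨c₁, hc₁, hr₁⟩ := h₁ a
    obtain ⟨c, hc, hr⟩ := hq a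
    obtain ⟨c₂, hc₂, hr₂⟩ := h₂ ((a, (l a).foldl (step a) (init a)), [])
    refine ⟨_, ?_, .comp (.comp hr₁ hr) hr₂⟩
    have := P₂.eval_nat_mono (hr.size_le.trans hc)
    simp [codeSize] at this hc₂ hc₁ hc ⊢
    omega
  obtain ⟨p, P, hp⟩ := hbody
  obtain ⟨c, C, hc⟩ := hcond
  let N : Polynomial ℕ := .X + Q + L + 3
  refine ⟨.loop c p, (L + 1) * (2 * (P.comp N + C.comp N + N) + 1), fun a => ?_⟩
  have hfold : ∀ (l' : List β) (s : σ),
      l'.foldl (fun (x : α × σ) b => (x.1, step x.1 x.2 b)) (a, s) = (a, l'.foldl (step a) s) := by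
    intro l'
    induction l' with
    | nil => intro s; rfl
    | cons b l' ih => intro s; simp [ih]
  have hsize : ∀ l₁ l₂, l₁ ++ l₂ = l a →
      codeSize ((a, l₁.foldl (step a) (init a)), l₂) ≤ N.eval (codeSize a) := by
    intro l₁ l₂ h
    have h1 := hQ a l₁ ⟨l₂, h⟩
    have h2 := codeSize_le_of_suffix ⟨l₁, h⟩
    have h3 := hL a
    simp [N]
    omega
  obtain ⟨d, hd, hr⟩ := WhileProg.Runs.loop_list (c := c) (p := p)
    (step := fun (x : α × σ) b => (x.1, step x.1 x.2 b))
    (K := (P.comp N + C.comp N + N).eval (codeSize a)) (l a) (a, init a)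
    (by
      intro l₁ l₂ h
      rw [hfold]
      obtain ⟨d, hd, hr⟩ := hc ((a, l₁.foldl (step a) (init a)), l₂)
      refine ⟨d, ?_, hr⟩
      have := C.eval_nat_mono (hsize l₁ l₂ h)
      simp only [Polynomial.eval_add, Polynomial.eval_comp]
      omega)
    (by
      intro l₁ b l₂ h
      rw [hfold]
      obtain ⟨d, hd, hr⟩ := hp ((a, l₁.foldl (step a) (init a)), b :: l₂)
      refine ⟨d, ?_, hr⟩
      have := P.eval_nat_mono (hsize l₁ (b :: l₂) h)
      simp only [Polynomial.eval_add, Polynomial.eval_comp]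
      omega)
    (by
      rw [hfold]
      have := hsize (l a) [] (by simp)
      simp only [Polynomial.eval_add, Polynomial.eval_comp]
      omega)
  rw [hfold] at hr
  refine ⟨d, hd.trans ?_, hr⟩
  have h1 := (length_lt_codeSize (l a)).le.trans (hL a)
  simp only [Polynomial.eval_mul, Polynomial.eval_add, Polynomial.eval_one, Polynomial.eval_ofNat]
  gcongr

end PolyTime

/-! ### Polynomial-time list operations -/

theorem codeSize_le_of_prefix {α : Type} [TreeCode α] {l₁ l₂ : List α} (h : l₁ <+: l₂) :
    codeSize l₁ ≤ codeSize l₂ := by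
  obtain ⟨t, rfl⟩ := h
  have := codeSize_append l₁ t
  have := one_le_codeSize t
  omega

theorem codeSize_list_le_mul {α : Type} [TreeCode α] (l : List α) {n B : ℕ} (hn : l.length ≤ n)
    (h : ∀ a ∈ l, codeSize a ≤ B) : codeSize l ≤ n * (B + 1) + 1 :=
  (codeSize_list_le l B h).trans (by gcongr)

theorem codeSize_listBool_le (l : List Bool) {n : ℕ} (hn : l.length ≤ n) :
    codeSize l ≤ 4 * n + 1 := by
  have := codeSize_list_le_mul l hn fun b _ => codeSize_bool_le b
  omega

theorem codeSize_matrix_le (l : List (List Bool)) {m n : ℕ} (hm : l.length ≤ m)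
    (hn : ∀ r ∈ l, r.length ≤ n) : codeSize l ≤ m * (4 * n + 2) + 1 :=
  codeSize_list_le_mul l hm fun r hr => codeSize_listBool_le r (hn r hr)

theorem List.exists_of_mem_zipWith {α β γ : Type*} {f : α → β → γ} {l : List α} {m : List β}
    {x : γ} (h : x ∈ List.zipWith f l m) : ∃ a ∈ l, ∃ b ∈ m, x = f a b := by
  induction l generalizing m with
  | nil => simp at h
  | cons a l ih =>
    cases m with
    | nil => simp at h
    | cons b m =>
      rw [List.zipWith_cons_cons, List.mem_cons] at h
      rcases h with rfl | h
      · exact ⟨a, by simp, b, by simp, rfl⟩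
      · obtain ⟨a', ha, b', hb, h⟩ := ih h
        exact ⟨a', by simp [ha], b', by simp [hb], h⟩

namespace PolyTime

variable {α β γ δ σ : Type} [TreeCode α] [TreeCode β] [TreeCode γ] [TreeCode δ] [TreeCode σ]

theorem reverse {l : α → List β} (hl : PolyTime l) : PolyTime fun a => (l a).reverse := by
  obtain ⟨L, hL⟩ := hl.exists_codeSize_le
  have key : ∀ l' m : List β, l'.foldl (fun s b => b :: s) m = l'.reverse ++ m := by
    intro l'
    induction l' with
    | nil => simp
    | cons b l' ih => intro m; simp [ih]
  have := foldl (step := fun (_ : α) (s : List β) b => b :: s) (init := fun _ => []) hl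
    (PolyTime.const _) ((PolyTime.snd.comp PolyTime.snd).cons (PolyTime.fst.comp PolyTime.snd)) L
    (by
      intro a l' h
      rw [key, List.append_nil, codeSize_reverse]
      exact (codeSize_le_of_prefix h).trans (hL a))
  simpa only [key, List.append_nil] using this

theorem foldr {l : α → List β} {init : α → σ} {step : α → β → σ → σ}
    (hl : PolyTime l) (hi : PolyTime init)
    (hs : PolyTime fun p : α × β × σ => step p.1 p.2.1 p.2.2) (Q : Polynomial ℕ)
    (hQ : ∀ a l', l' <:+ l a → codeSize (l'.foldr (step a) (init a)) ≤ Q.eval (codeSize a)) :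
    PolyTime fun a => (l a).foldr (step a) (init a) := by
  have hs' : PolyTime fun p : α × σ × β => step p.1 p.2.2 p.2.1 :=
    hs.comp (f := fun p : α × σ × β => (p.1, p.2.2, p.2.1)) (PolyTime.fst.pair
      ((PolyTime.snd.comp PolyTime.snd).pair (PolyTime.fst.comp PolyTime.snd)))
  have := foldl (step := fun a s b => step a b s) hl.reverse hi hs' Q (by
    intro a l' h
    have := hQ a l'.reverse (by rwa [← List.reverse_prefix, List.reverse_reverse])
    rwa [List.foldr_reverse] at this)
  simpa only [List.foldl_reverse] using this

theorem foldr_bool {l : α → List β} {init : α → Bool} {step : α → β → Bool → Bool}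
    (hl : PolyTime l) (hi : PolyTime init)
    (hs : PolyTime fun p : α × β × Bool => step p.1 p.2.1 p.2.2) :
    PolyTime fun a => (l a).foldr (step a) (init a) :=
  foldr hl hi hs 3 fun a l' _ => by simpa using codeSize_bool_le _

theorem map {l : α → List β} {f : α → β → γ} (hl : PolyTime l)
    (hf : PolyTime fun p : α × β => f p.1 p.2) : PolyTime fun a => (l a).map (f a) := by
  obtain ⟨L, hL⟩ := hl.exists_codeSize_le
  obtain ⟨F, hF⟩ := hf.exists_codeSize_le
  have := foldr (step := fun a b s => f a b :: s) (init := fun _ => []) hl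
    (PolyTime.const _) ((hf.comp (f := fun p : α × β × List γ => (p.1, p.2.1))
      (PolyTime.fst.pair (PolyTime.fst.comp PolyTime.snd))).cons (PolyTime.snd.comp PolyTime.snd))
    (L * (F.comp (.X + L + 1) + 1) + 1)
    (by
      intro a l' h
      rw [← List.map_eq_foldr]
      have h1 : (l'.map (f a)).length ≤ L.eval (codeSize a) := by
        rw [List.length_map]
        exact h.length_le.trans ((length_lt_codeSize _).le.trans (hL a))
      have h2 : ∀ x ∈ l'.map (f a), codeSize x ≤ F.eval (codeSize a + L.eval (codeSize a) + 1) := by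
        intro x hx
        obtain ⟨b, hb, rfl⟩ := List.mem_map.1 hx
        refine (hF (a, b)).trans (F.eval_nat_mono ?_)
        have := (codeSize_le_of_mem (h.subset hb)).trans (hL a)
        simp
        omega
      simpa using codeSize_list_le_mul _ h1 h2)
  simpa only [← List.map_eq_foldr] using this

theorem append {l m : α → List β} (hl : PolyTime l) (hm : PolyTime m) :
    PolyTime fun a => l a ++ m a := by
  obtain ⟨L, hL⟩ := hl.exists_codeSize_le
  obtain ⟨M, hM⟩ := hm.exists_codeSize_le
  have key : ∀ l₁ l₂ : List β, l₁.foldr (fun b s => b :: s) l₂ = l₁ ++ l₂ := by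
    intro l₁ l₂
    induction l₁ with
    | nil => rfl
    | cons b l₁ ih => simp [ih]
  have := foldr (step := fun (_ : α) (b : β) s => b :: s) hl hm
    ((PolyTime.fst.comp PolyTime.snd).cons (PolyTime.snd.comp PolyTime.snd))
    (L + M) (by
      intro a l' h
      rw [key]
      have := codeSize_append l' (m a)
      have := (codeSize_le_of_suffix h).trans (hL a)
      have := hM a
      simp
      omega)
  simpa only [key] using this

theorem zipWith {l : α → List β} {m : α → List γ} {f : α → β → γ → δ} (hl : PolyTime l)
    (hm : PolyTime m) (hf : PolyTime fun p : α × β × γ => f p.1 p.2.1 p.2.2) :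
    PolyTime fun a => List.zipWith (f a) (l a) (m a) := by
  obtain ⟨L, hL⟩ := hl.exists_codeSize_le
  obtain ⟨M, hM⟩ := hm.exists_codeSize_le
  obtain ⟨F, hF⟩ := hf.exists_codeSize_le
  let step : α → List γ × List δ → β → List γ × List δ := fun a s b =>
    match s.1 with
    | [] => s
    | c :: r => (r, f a b c :: s.2)
  have key : ∀ a (l' : List β) (r : List γ) (acc : List δ), l'.foldl (step a) (r, acc) =
      (r.drop l'.length, (List.zipWith (f a) l' r).reverse ++ acc) := by
    intro a l'
    induction l' with
    | nil => simp
    | cons b l' ih =>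
      intro r acc
      cases r with
      | nil => simp [step, ih]
      | cons c r => simp [step, ih]
  have hstep : PolyTime fun p : α × (List γ × List δ) × β => step p.1 p.2.1 p.2.2 := by
    have h1 : PolyTime fun p : α × (List γ × List δ) × β => p.2.1 :=
      PolyTime.fst.comp PolyTime.snd
    refine listCases (g := fun y : (α × (List γ × List δ) × β) × γ × List γ =>
      (y.2.2, f y.1.1 y.1.2.2 y.2.1 :: y.1.2.1.2)) (PolyTime.fst.comp h1) h1 ?_
    have h2 : PolyTime fun y : (α × (List γ × List δ) × β) × γ × List γ => y.1 := PolyTime.fst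
    have h3 : PolyTime fun y : (α × (List γ × List δ) × β) × γ × List γ => y.2 := PolyTime.snd
    exact (PolyTime.snd.comp h3).pair ((hf.comp ((PolyTime.fst.comp h2).pair
      ((PolyTime.snd.comp (PolyTime.snd.comp h2)).pair (PolyTime.fst.comp h3)))).cons
      (PolyTime.snd.comp (PolyTime.fst.comp (PolyTime.snd.comp h2))))
  have := foldl hl (hm.pair (PolyTime.const ([] : List δ))) hstep
    (M + (L * (F.comp (.X + L + M + 2) + 1) + 1) + 1) (by
      intro a l' h
      rw [key, List.append_nil, codeSize_pair, codeSize_reverse]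
      have h0 := (codeSize_le_of_suffix (List.drop_suffix l'.length (m a))).trans (hM a)
      have h1 : (List.zipWith (f a) l' (m a)).length ≤ L.eval (codeSize a) := by
        rw [List.length_zipWith]
        exact (min_le_left _ _).trans
          (h.length_le.trans ((length_lt_codeSize _).le.trans (hL a)))
      have h2 : ∀ x ∈ List.zipWith (f a) l' (m a), codeSize x ≤
          F.eval (codeSize a + L.eval (codeSize a) + M.eval (codeSize a) + 2) := by
        intro x hx
        obtain ⟨b, hb, c, hc, rfl⟩ := List.exists_of_mem_zipWith hx
        refine (hF (a, b, c)).trans (F.eval_nat_mono ?_)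
        have := (codeSize_le_of_mem (h.subset hb)).trans (hL a)
        have := (codeSize_le_of_mem hc).trans (hM a)
        simp
        omega
      have h3 := codeSize_list_le_mul _ h1 h2
      simp only [Polynomial.eval_add, Polynomial.eval_mul, Polynomial.eval_comp,
        Polynomial.eval_one, Polynomial.eval_X, Polynomial.eval_ofNat]
      omega)
  have := (PolyTime.snd.comp this).reverse
  simpa only [key, List.append_nil, List.reverse_reverse] using this

theorem and {f g : α → Bool} (hf : PolyTime f) (hg : PolyTime g) :
    PolyTime fun a => f a && g a := by
  have := hf.cond hg (PolyTime.const false)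
  simpa only [Bool.cond_false_right] using this

theorem or {f g : α → Bool} (hf : PolyTime f) (hg : PolyTime g) :
    PolyTime fun a => f a || g a := by
  have := hf.cond (PolyTime.const true) hg
  simpa only [Bool.cond_true_left] using this

theorem xor {f g : α → Bool} (hf : PolyTime f) (hg : PolyTime g) :
    PolyTime fun a => f a ^^ g a := by
  have := hf.cond (hg.cond (PolyTime.const false) (PolyTime.const true)) hg
  have h : ∀ a, (bif f a then (bif g a then false else true) else g a) = (f a ^^ g a) := by
    intro a
    cases f a <;> cases g a <;> rfl
  simpa only [h] using this

theorem any {l : α → List β} {q : α → β → Bool} (hl : PolyTime l)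
    (hq : PolyTime fun p : α × β => q p.1 p.2) : PolyTime fun a => (l a).any (q a) := by
  have := foldr_bool (step := fun a b s => q a b || s) hl (PolyTime.const false)
    ((hq.comp (f := fun p : α × β × Bool => (p.1, p.2.1))
      (PolyTime.fst.pair (PolyTime.fst.comp PolyTime.snd))).or (PolyTime.snd.comp PolyTime.snd))
  have h : ∀ a, (l a).foldr (fun b s => q a b || s) false = (l a).any (q a) := by
    intro a
    induction l a with
    | nil => rfl
    | cons b l ih => simp [ih]
  simpa only [h] using this

end PolyTime

/-! ### Linear algebra over `𝔽₂` on lists of bits -/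

namespace BitList

/-- Entrywise sum. -/
def add (v w : List Bool) : List Bool := List.zipWith xor v w

/-- Standard bilinear form. -/
def dot (v w : List Bool) : Bool := (List.zipWith and v w).foldr xor false

/-- The zero vector as long as the list `l`. -/
def zeros {α : Type} (l : List α) : List Bool := l.map fun _ => false

/-- The first vector with the property `q`, or `[]`. -/
def pick (q : List Bool → Bool) (L : List (List Bool)) : List Bool :=
  L.foldr (fun v p => bif q v then v else p) []

/-- The identity matrix of the size of the list `l`. -/
def identity {α : Type} (l : List α) : List (List Bool) :=
  l.foldr (fun _ M => (true :: zeros M) :: M.map (List.cons false)) []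

/-- The transpose of a matrix with as many columns as `u` has entries. -/
def transpose {α : Type} (u : List α) (M : List (List Bool)) : List (List Bool) :=
  M.foldr (fun r acc => List.zipWith List.cons r acc) (u.map fun _ => [])

/-- Pivot step: if `L` spans `V` then the result spans the vectors of `V` orthogonal to `r`. -/
def restrict (r : List Bool) (L : List (List Bool)) : List (List Bool) :=
  L.map fun v => bif dot r v then add v (pick (dot r) L) else v

/-- A list that spans the kernel of a matrix with as many columns as `u` has entries. -/
def kernel {α : Type} (u : List α) (M : List (List Bool)) : List (List Bool) :=
  M.foldr restrict (identity u)

/-- Changes the last `true` to `false`. -/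
def dropTrue : List Bool → List Bool
  | [] => []
  | b :: l => (b && l.any fun x => x) :: dropTrue l

theorem length_add {v w : List Bool} {n : ℕ} (hv : v.length = n) (hw : w.length = n) :
    (add v w).length = n := by simp [add, hv, hw]

@[simp] theorem length_zeros {α : Type} (l : List α) : (zeros l).length = l.length := by
  simp [zeros]

@[simp] theorem length_dropTrue (l : List Bool) : (dropTrue l).length = l.length := by
  induction l with
  | nil => rfl
  | cons b l ih => simp [dropTrue, ih]

theorem pick_eq_or (q : List Bool → Bool) (L : List (List Bool)) :
    (pick q L = [] ∧ ∀ v ∈ L, q v = false) ∨ (pick q L ∈ L ∧ q (pick q L) = true) := by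
  induction L with
  | nil => simp [pick]
  | cons v L ih =>
    have h : pick q (v :: L) = bif q v then v else pick q L := rfl
    rw [h]
    cases hq : q v with
    | true => simp [hq]
    | false =>
      rcases ih with ⟨h1, h2⟩ | ⟨h1, h2⟩
      · left; simpa [h1, hq] using h2
      · right; simp [h1, h2]

theorem length_identity {α : Type} (l : List α) : (identity l).length = l.length := by
  induction l with
  | nil => rfl
  | cons a l ih => simpa [identity] using ih

theorem length_of_mem_identity {α : Type} (l : List α) :
    ∀ r ∈ identity l, r.length = l.length := by
  induction l with
  | nil => simp [identity]
  | cons a l ih =>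
    have h : identity (a :: l) =
      (true :: zeros (identity l)) :: (identity l).map (List.cons false) := rfl
    intro r hr
    rw [h, List.mem_cons, List.mem_map] at hr
    rcases hr with rfl | ⟨s, hs, rfl⟩
    · simp [length_identity]
    · simp [ih s hs]

theorem length_transpose_le {α : Type} (u : List α) (M : List (List Bool)) :
    (transpose u M).length ≤ u.length := by
  induction M with
  | nil => simp [transpose]
  | cons r M ih =>
    change (List.zipWith List.cons r (transpose u M)).length ≤ _
    rw [List.length_zipWith]
    omega

theorem length_of_mem_transpose {α : Type} (u : List α) (M : List (List Bool)) :
    ∀ c ∈ transpose u M, c.length = M.length := by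
  induction M with
  | nil => simp [transpose]
  | cons r M ih =>
    intro c hc
    change c ∈ List.zipWith List.cons r (transpose u M) at hc
    obtain ⟨b, -, c', hc', rfl⟩ := List.exists_of_mem_zipWith hc
    simp [ih c' hc']

@[simp] theorem length_restrict (r : List Bool) (L : List (List Bool)) :
    (restrict r L).length = L.length := by simp [restrict]

theorem length_of_mem_restrict {r : List Bool} {L : List (List Bool)} {n : ℕ}
    (h : ∀ v ∈ L, v.length = n) : ∀ v ∈ restrict r L, v.length = n := by
  intro v hv
  obtain ⟨w, hw, rfl⟩ := List.mem_map.1 hv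
  cases hd : dot r w with
  | false => simpa using h w hw
  | true =>
    rcases pick_eq_or (dot r) L with ⟨-, h2⟩ | ⟨h1, -⟩
    · simp [h2 w hw] at hd
    · exact length_add (h w hw) (h _ h1)

theorem length_kernel {α : Type} (u : List α) (M : List (List Bool)) :
    (kernel u M).length = u.length := by
  induction M with
  | nil => exact length_identity u
  | cons r M ih => exact (length_restrict _ _).trans ih

theorem length_of_mem_kernel {α : Type} (u : List α) (M : List (List Bool)) :
    ∀ v ∈ kernel u M, v.length = u.length := by
  induction M with
  | nil => exact length_of_mem_identity u
  | cons r M ih => exact length_of_mem_restrict ih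

end BitList

namespace PolyTime

open BitList

variable {α β : Type} [TreeCode α] [TreeCode β]

theorem bitAdd {f g : α → List Bool} (hf : PolyTime f) (hg : PolyTime g) :
    PolyTime fun a => add (f a) (g a) :=
  zipWith (f := fun _ => Bool.xor) hf hg
    ((PolyTime.fst.comp PolyTime.snd).xor (PolyTime.snd.comp PolyTime.snd))

theorem bitDot {f g : α → List Bool} (hf : PolyTime f) (hg : PolyTime g) :
    PolyTime fun a => dot (f a) (g a) :=
  foldr_bool (step := fun _ => Bool.xor)
    (zipWith (f := fun _ => Bool.and) hf hg
      ((PolyTime.fst.comp PolyTime.snd).and (PolyTime.snd.comp PolyTime.snd)))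
    (PolyTime.const false)
    ((PolyTime.fst.comp PolyTime.snd).xor (PolyTime.snd.comp PolyTime.snd))

theorem bitZeros {f : α → List β} (hf : PolyTime f) : PolyTime fun a => zeros (f a) :=
  map hf (PolyTime.const false)

theorem bitPick {L : α → List (List Bool)} {q : α → List Bool → Bool} (hL : PolyTime L)
    (hq : PolyTime fun p : α × List Bool => q p.1 p.2) : PolyTime fun a => pick (q a) (L a) := by
  obtain ⟨P, hP⟩ := hL.exists_codeSize_le
  have h1 : PolyTime fun p : α × List Bool × List Bool => p.2.1 :=
    PolyTime.fst.comp PolyTime.snd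
  refine foldr (step := fun a v p => bif q a v then v else p) hL (PolyTime.const [])
    ((hq.comp (PolyTime.fst.pair h1)).cond h1 (PolyTime.snd.comp PolyTime.snd)) (P + 1) ?_
  intro a l' h
  change codeSize (pick (q a) l') ≤ _
  rcases pick_eq_or (q a) l' with ⟨h1, -⟩ | ⟨h1, -⟩
  · simp [h1]
  · have := (codeSize_le_of_mem (h.subset h1)).trans (hP a)
    simp
    omega

theorem bitIdentity {l : α → List β} (hl : PolyTime l) : PolyTime fun a => identity (l a) := by
  obtain ⟨P, hP⟩ := hl.exists_codeSize_le
  have h1 : PolyTime fun p : α × β × List (List Bool) => p.2.2 :=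
    PolyTime.snd.comp PolyTime.snd
  refine foldr (step := fun (_ : α) (_ : β) M => (true :: zeros M) :: M.map (List.cons false)) hl
    (PolyTime.const []) (((PolyTime.const true).cons h1.bitZeros).cons
      (map (f := fun _ => List.cons false) h1 ((PolyTime.const false).cons PolyTime.snd)))
    (P * (4 * P + 2) + 1) ?_
  intro a l' h
  have h2 : l'.length ≤ P.eval (codeSize a) :=
    h.length_le.trans ((length_lt_codeSize _).le.trans (hP a))
  change codeSize (identity l') ≤ _
  have := codeSize_matrix_le (identity l') ((length_identity l').le.trans h2)
    fun r hr => (length_of_mem_identity l' r hr).le.trans h2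
  simpa using this

theorem bitTranspose {u : α → List β} {M : α → List (List Bool)} (hu : PolyTime u)
    (hM : PolyTime M) : PolyTime fun a => transpose (u a) (M a) := by
  obtain ⟨U, hU⟩ := hu.exists_codeSize_le
  obtain ⟨P, hP⟩ := hM.exists_codeSize_le
  refine foldr (step := fun _ r acc => List.zipWith List.cons r acc) hM
    (map (f := fun _ _ => ([] : List Bool)) hu (PolyTime.const []))
    (zipWith (f := fun _ => List.cons) (PolyTime.fst.comp PolyTime.snd)
      (PolyTime.snd.comp PolyTime.snd)
      ((PolyTime.fst.comp PolyTime.snd).cons (PolyTime.snd.comp PolyTime.snd)))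
    (U * (4 * P + 2) + 1) ?_
  intro a l' h
  change codeSize (transpose (u a) l') ≤ _
  have := codeSize_matrix_le (transpose (u a) l')
    ((length_transpose_le _ _).trans ((length_lt_codeSize _).le.trans (hU a)))
    fun r hr => (length_of_mem_transpose _ l' r hr).le.trans
      (h.length_le.trans ((length_lt_codeSize _).le.trans (hP a)))
  simpa using this

theorem bitRestrict {r : α → List Bool} {L : α → List (List Bool)} (hr : PolyTime r)
    (hL : PolyTime L) : PolyTime fun a => restrict (r a) (L a) := by
  have h1 : PolyTime fun p : α × List Bool => dot (r p.1) p.2 :=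
    (hr.comp PolyTime.fst).bitDot PolyTime.snd
  have h2 : PolyTime fun a => pick (dot (r a)) (L a) := bitPick hL h1
  exact map hL (h1.cond (PolyTime.snd.bitAdd (h2.comp PolyTime.fst)) PolyTime.snd)

theorem bitKernel {u : α → List β} {M : α → List (List Bool)} (hu : PolyTime u)
    (hM : PolyTime M) : PolyTime fun a => kernel (u a) (M a) := by
  obtain ⟨U, hU⟩ := hu.exists_codeSize_le
  refine foldr (step := fun _ => restrict) hM hu.bitIdentity
    ((PolyTime.fst.comp PolyTime.snd).bitRestrict (PolyTime.snd.comp PolyTime.snd))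
    (U * (4 * U + 2) + 1) ?_
  intro a l' h
  have hl := (length_lt_codeSize (u a)).le.trans (hU a)
  change codeSize (kernel (u a) l') ≤ _
  have := codeSize_matrix_le (kernel (u a) l') ((length_kernel _ _).le.trans hl)
    fun r hr => (length_of_mem_kernel _ l' r hr).le.trans hl
  simpa using this

theorem bitDropTrue {f : α → List Bool} (hf : PolyTime f) :
    PolyTime fun a => dropTrue (f a) := by
  obtain ⟨P, hP⟩ := hf.exists_codeSize_le
  have key : ∀ l : List Bool,
      l.foldr (fun b s => (b || s.1, (b && s.1) :: s.2)) (false, []) =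
        (l.any fun x => x, dropTrue l) := by
    intro l
    induction l with
    | nil => rfl
    | cons b l ih => rw [List.foldr_cons, ih]; rfl
  have h1 : PolyTime fun p : α × Bool × Bool × List Bool => p.2.1 :=
    PolyTime.fst.comp PolyTime.snd
  have h2 : PolyTime fun p : α × Bool × Bool × List Bool => p.2.2 :=
    PolyTime.snd.comp PolyTime.snd
  have h3 := PolyTime.fst.comp h2
  have := foldr (step := fun (_ : α) (b : Bool) (s : Bool × List Bool) =>
      (b || s.1, (b && s.1) :: s.2)) (init := fun _ => (false, [])) hf (PolyTime.const _)
    ((h1.or h3).pair ((h1.and h3).cons (PolyTime.snd.comp h2))) (4 * P + 5) (by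
      intro a l' h
      rw [key, codeSize_pair]
      have h4 := codeSize_bool_le (l'.any fun x => x)
      have h5 := codeSize_listBool_le (dropTrue l') (n := P.eval (codeSize a)) (by
        rw [length_dropTrue]
        exact h.length_le.trans ((length_lt_codeSize _).le.trans (hP a)))
      simp
      omega)
  simp only [key] at this
  exact PolyTime.snd.comp this

end PolyTime

namespace BitList

/-- A bit as an element of `𝔽₂`. -/
def bit (b : Bool) : ZMod 2 := if b then 1 else 0

@[simp] theorem bit_true : bit true = 1 := rfl
@[simp] theorem bit_false : bit false = 0 := rfl
theorem bit_xor (a b : Bool) : bit (a ^^ b) = bit a + bit b := by revert a b; decide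
theorem bit_and (a b : Bool) : bit (a && b) = bit a * bit b := by revert a b; decide
@[simp] theorem bit_eq_one {b : Bool} : bit b = 1 ↔ b = true := by revert b; decide
@[simp] theorem bit_eq_zero {b : Bool} : bit b = 0 ↔ b = false := by revert b; decide
@[simp] theorem bit_decide (a : ZMod 2) : bit (decide (a = 1)) = a := by revert a; decide

/-- The vector with the entries of a list. -/
def vec (n : ℕ) (v : List Bool) : Fin n → ZMod 2 := fun i => bit (v.getD i false)

/-- The sum of the `g i` over the positions `i` of the entries `true`. -/
def eval {M : Type*} [AddCommMonoid M] : List Bool → (ℕ → M) → M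
  | [], _ => 0
  | b :: l, g => (if b then g 0 else 0) + eval l fun i => g (i + 1)

@[simp] theorem vec_nil (n : ℕ) : vec n [] = 0 := by ext; simp [vec]

theorem vec_ofFn {n : ℕ} (f : Fin n → ZMod 2) :
    vec n (List.ofFn fun i => decide (f i = 1)) = f := by
  ext i
  simp [vec]

theorem eval_eq_sum {M : Type*} [AddCommMonoid M] {n : ℕ} (v : List Bool) (g : ℕ → M)
    (hv : v.length = n) : eval v g = ∑ i : Fin n, if v.getD i false then g i else 0 := by
  induction v generalizing n g with
  | nil => subst hv; simp [eval]
  | cons b l ih =>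
    subst hv
    simp only [List.length_cons]
    rw [Fin.sum_univ_succ, eval, ih _ rfl]
    simp

theorem eval_append {M : Type*} [AddCommMonoid M] (v w : List Bool) (g : ℕ → M) :
    eval (v ++ w) g = eval v g + eval w fun i => g (v.length + i) := by
  induction v generalizing g with
  | nil => simp [eval]
  | cons b l ih =>
    simp only [List.cons_append, eval, ih, add_assoc, List.length_cons]
    congr 3
    ext i
    congr 1
    omega

@[simp] theorem eval_zeros {M : Type*} [AddCommMonoid M] {α : Type} (l : List α) (g : ℕ → M) :
    eval (zeros l) g = 0 := by
  induction l generalizing g with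
  | nil => rfl
  | cons a l ih =>
    have : zeros (a :: l) = false :: zeros l := rfl
    simp [this, eval, ih]

theorem eval_add {M : Type*} [AddCommGroup M] [Module (ZMod 2) M] {v w : List Bool}
    (h : v.length = w.length) (g : ℕ → M) : eval (add v w) g = eval v g + eval w g := by
  induction v generalizing w g with
  | nil =>
    have : w = [] := by simpa using h.symm
    subst this
    simp [add, eval]
  | cons a v ih =>
    cases w with
    | nil => simp at h
    | cons b w =>
      have h1 : add (a :: v) (b :: w) = (a ^^ b) :: add v w := rfl
      have h2 : g 0 + g 0 = 0 := ZModModule.add_self _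
      rw [h1, eval, ih (by simpa using h)]
      cases a <;> cases b <;> simp [eval] <;>
        first | rw [add_add_add_comm, h2, zero_add] | abel

theorem eval_identity {M : Type*} [AddCommMonoid M] {α : Type} (l : List α) (g : ℕ → M) (i : ℕ)
    (hi : i < (identity l).length) : eval (identity l)[i] g = g i := by
  induction l generalizing i g with
  | nil => simp [identity] at hi
  | cons a l ih =>
    have h : identity (a :: l) =
      (true :: zeros (identity l)) :: (identity l).map (List.cons false) := rfl
    simp only [h]
    cases i with
    | zero => simp [eval]
    | succ i =>
      simp only [h, List.length_cons, List.length_map] at hi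
      simp only [List.getElem_cons_succ, List.getElem_map, eval]
      rw [ih _ _ (by omega)]
      simp

/-- The standard basis of `𝔽₂ⁿ`, extended by zero. -/
def basisVec (n i : ℕ) : Fin n → ZMod 2 := if h : i < n then Pi.single ⟨i, h⟩ 1 else 0

theorem eval_basisVec {n : ℕ} (v : List Bool) (hv : v.length = n) :
    eval v (basisVec n) = vec n v := by
  rw [eval_eq_sum v _ hv]
  ext j
  rw [Finset.sum_apply, Finset.sum_eq_single j]
  · cases h : v.getD j false <;> simp [vec, basisVec, h, -List.getD_eq_getElem?_getD]
  · intro i _ hij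
    cases h : v.getD i false <;>
      simp [basisVec, -List.getD_eq_getElem?_getD, Pi.single_eq_of_ne hij.symm]
  · simp

theorem vec_add {n : ℕ} {v w : List Bool} (hv : v.length = n) (hw : w.length = n) :
    vec n (add v w) = vec n v + vec n w := by
  rw [← eval_basisVec _ hv, ← eval_basisVec _ hw, ← eval_basisVec _ (length_add hv hw),
    eval_add (hv.trans hw.symm)]

theorem bit_dot {n : ℕ} {v w : List Bool} (hv : v.length = n) :
    bit (dot v w) = vec n v ⬝ᵥ vec n w := by
  induction v generalizing n w with
  | nil => subst hv; simp [dot, dotProduct]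
  | cons a v ih =>
    subst hv
    cases w with
    | nil => simp [dot]
    | cons b w =>
      have h : dot (a :: v) (b :: w) = ((a && b) ^^ dot v w) := rfl
      rw [h, bit_xor, bit_and, ih rfl, dotProduct, dotProduct, List.length_cons,
        Fin.sum_univ_succ]
      simp [vec]

/-- The span of a list of vectors. -/
def spanOf (n : ℕ) (L : List (List Bool)) : Submodule (ZMod 2) (Fin n → ZMod 2) :=
  Submodule.span (ZMod 2) (vec n '' {v | v ∈ L})

theorem vec_mem_spanOf {n : ℕ} {L : List (List Bool)} {v : List Bool} (h : v ∈ L) :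
    vec n v ∈ spanOf n L := Submodule.subset_span ⟨v, h, rfl⟩

theorem spanOf_identity {α : Type} (l : List α) : spanOf l.length (identity l) = ⊤ := by
  rw [eq_top_iff, ← (Pi.basisFun (ZMod 2) (Fin l.length)).span_eq, Submodule.span_le]
  rintro _ ⟨i, rfl⟩
  have hi : (i : ℕ) < (identity l).length := by rw [length_identity]; exact i.2
  have h := vec_mem_spanOf (n := l.length) (List.getElem_mem hi)
  rw [← eval_basisVec _ (length_of_mem_identity l _ (List.getElem_mem hi)), eval_identity] at h
  simpa [basisVec] using h

theorem mem_spanOf_restrict {n : ℕ} {r : List Bool} {L : List (List Bool)} (hr : r.length = n)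
    (hL : ∀ v ∈ L, v.length = n) (x : Fin n → ZMod 2) :
    x ∈ spanOf n (restrict r L) ↔ x ∈ spanOf n L ∧ vec n r ⬝ᵥ x = 0 := by
  let f : (Fin n → ZMod 2) →ₗ[ZMod 2] ZMod 2 :=
    { toFun := fun x => vec n r ⬝ᵥ x
      map_add' := dotProduct_add _
      map_smul' := fun c x => dotProduct_smul c _ x }
  let p := vec n (pick (dot r) L)
  have hp : p ∈ spanOf n L := by
    rcases pick_eq_or (dot r) L with ⟨h1, -⟩ | ⟨h1, -⟩
    · simp [p, h1]
    · exact vec_mem_spanOf h1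
  have hfp : f p = 1 ∨ ∀ y ∈ spanOf n L, f y = 0 := by
    rcases pick_eq_or (dot r) L with ⟨-, h2⟩ | ⟨-, h2⟩
    · right
      change spanOf n L ≤ LinearMap.ker f
      refine Submodule.span_le.2 ?_
      rintro _ ⟨v, hv, rfl⟩
      change vec n r ⬝ᵥ vec n v = 0
      rw [← bit_dot hr, h2 v hv, bit_false]
    · left
      change vec n r ⬝ᵥ p = 1
      rw [← bit_dot hr, h2, bit_true]
  let T : (Fin n → ZMod 2) →ₗ[ZMod 2] (Fin n → ZMod 2) := LinearMap.id + f.smulRight p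
  have hT : ∀ y, T y = y + f y • p := fun y => rfl
  have himage : vec n '' {v | v ∈ restrict r L} = T '' (vec n '' {v | v ∈ L}) := by
    have : {v | v ∈ restrict r L} =
        (fun v => bif dot r v then add v (pick (dot r) L) else v) '' {v | v ∈ L} := by
      ext v
      simp [restrict]
    rw [this, Set.image_image, Set.image_image]
    refine Set.image_congr fun v hv => ?_
    have hfv : f (vec n v) = bit (dot r v) := (bit_dot hr).symm
    rw [hT, hfv]
    cases hd : dot r v with
    | false => simp
    | true =>
      rcases pick_eq_or (dot r) L with ⟨-, h2⟩ | ⟨h1, -⟩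
      · simp [h2 v hv] at hd
      · simp [p, vec_add (hL v hv) (hL _ h1)]
  have hspan : spanOf n (restrict r L) = (spanOf n L).map T := by
    rw [spanOf, himage, spanOf, Submodule.map_span]
  rw [hspan, Submodule.mem_map]
  constructor
  · rintro ⟨y, hy, rfl⟩
    refine ⟨add_mem hy (Submodule.smul_mem _ _ hp), ?_⟩
    change f (T y) = 0
    rw [hT, map_add, map_smul]
    rcases hfp with h | h
    · rw [h, smul_eq_mul, mul_one]
      exact ZModModule.add_self _
    · rw [h y hy]; simp
  · rintro ⟨hx, h0⟩
    refine ⟨x, hx, ?_⟩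
    have : f x = 0 := h0
    rw [hT, this]
    simp

theorem mem_spanOf_kernel {α : Type} (u : List α) (M : List (List Bool))
    (hM : ∀ r ∈ M, r.length = u.length) (x : Fin u.length → ZMod 2) :
    x ∈ spanOf u.length (kernel u M) ↔ ∀ r ∈ M, vec u.length r ⬝ᵥ x = 0 := by
  induction M with
  | nil =>
    have : kernel u [] = identity u := rfl
    simp [this, spanOf_identity]
  | cons r M ih =>
    have : kernel u (r :: M) = restrict r (kernel u M) := rfl
    rw [this, mem_spanOf_restrict (hM r (by simp)) (length_of_mem_kernel u M),
      ih fun s hs => hM s (by simp [hs])]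
    simp [and_comm]

/-- The rows of a matrix. -/
def ofMatrix {m n : ℕ} (M : Matrix (Fin m) (Fin n) (ZMod 2)) : List (List Bool) :=
  List.ofFn fun x => List.ofFn fun y => decide (M x y = 1)

theorem transpose_ofMatrix {α : Type} {m n : ℕ} (u : List α) (hu : u.length = n)
    (M : Matrix (Fin m) (Fin n) (ZMod 2)) : transpose u (ofMatrix M) = ofMatrix M.transpose := by
  induction m with
  | zero =>
    subst hu
    simp [ofMatrix, transpose, List.ofFn_const]
  | succ m ih =>
    have h1 : ofMatrix M = (List.ofFn fun y => decide (M 0 y = 1)) ::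
        ofMatrix (Matrix.of fun x y => M (Fin.succ x) y) := by
      simp only [ofMatrix, List.ofFn_succ]
      rfl
    rw [h1]
    change List.zipWith List.cons _ (transpose u _) = _
    rw [ih]
    apply List.ext_getElem
    · simp [ofMatrix]
    · intro i h1 h2
      simp [ofMatrix, List.ofFn_succ, Matrix.transpose_apply]
      exact ⟨rfl, rfl⟩

theorem mem_spanOf_kernel_ofMatrix {α : Type} {m n : ℕ} (u : List α) (hu : u.length = n)
    (M : Matrix (Fin m) (Fin n) (ZMod 2)) (x : Fin n → ZMod 2) :
    x ∈ spanOf n (kernel u (ofMatrix M)) ↔ M.mulVec x = 0 := by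
  subst hu
  rw [mem_spanOf_kernel]
  · simp only [ofMatrix, List.mem_ofFn', Set.forall_mem_range, vec_ofFn, funext_iff]
    rfl
  · simp [ofMatrix, List.mem_ofFn']

theorem exists_orthogonal_of_notMem_range {m n : ℕ} (A : Matrix (Fin m) (Fin n) (ZMod 2))
    (x : Fin n → ZMod 2) (hx : x ∉ LinearMap.range A.transpose.mulVecLin) :
    ∃ f, A.mulVec f = 0 ∧ x ⬝ᵥ f ≠ 0 := by
  obtain ⟨φ, hφ, h0⟩ := Submodule.exists_le_ker_of_notMem hx
  have hφ' : ∀ y, φ y = y ⬝ᵥ fun i => φ (Pi.single i 1) := by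
    intro y
    conv_lhs => rw [pi_eq_sum_univ' y, map_sum]
    simp [dotProduct]
  refine ⟨fun i => φ (Pi.single i 1), ?_, ?_⟩
  · have h1 : ∀ w, w ⬝ᵥ A.mulVec (fun i => φ (Pi.single i 1)) = 0 := by
      intro w
      rw [Matrix.dotProduct_mulVec, ← hφ', ← Matrix.mulVec_transpose]
      exact h0 ⟨w, rfl⟩
    ext i
    simpa using h1 (Pi.single i 1)
  · rwa [← hφ']

/-- A vector orthogonal to the columns of `B` that is not in the row space of `A`, if one exists. -/
def cocycle {α β : Type} (u : List α) (w : List β) (A B : List (List Bool)) : List Bool :=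
  pick (fun v => (kernel u A).any (dot v)) (kernel u (transpose w B))

theorem cocycle_spec (X : F2Complex) (h : Nontrivial X.Cohomology) {α β : Type} (u : List α)
    (hu : u.length = X.n₁) (w : List β) (hw : w.length = X.n₂) :
    (cocycle u w (ofMatrix X.bd₁) (ofMatrix X.bd₂)).length = X.n₁ ∧
    vec X.n₁ (cocycle u w (ofMatrix X.bd₁) (ofMatrix X.bd₂)) ∈ X.cocycles ∧
    vec X.n₁ (cocycle u w (ofMatrix X.bd₁) (ofMatrix X.bd₂)) ∉ X.coboundaries := by
  obtain ⟨x, hx, hxb⟩ : ∃ x ∈ X.cocycles, x ∉ X.coboundaries := by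
    by_contra! hc
    have : X.coboundaries.submoduleOf X.cocycles = ⊤ := by
      ext y
      simpa [Submodule.submoduleOf] using hc y y.2
    exact not_subsingleton_iff_nontrivial.2 h (Submodule.Quotient.subsingleton_iff.2 this)
  have hA := mem_spanOf_kernel_ofMatrix u hu X.bd₁
  have hB := mem_spanOf_kernel_ofMatrix u hu X.bd₂.transpose
  rw [← transpose_ofMatrix w hw] at hB
  have hlen := hu ▸ length_of_mem_kernel u (transpose w (ofMatrix X.bd₂))
  rcases pick_eq_or (fun v => (kernel u (ofMatrix X.bd₁)).any (dot v))
    (kernel u (transpose w (ofMatrix X.bd₂))) with ⟨-, h2⟩ | ⟨h1, h2⟩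
  · exfalso
    obtain ⟨f, hf, hxf⟩ := exists_orthogonal_of_notMem_range X.bd₁ x hxb
    have hf' := (hA f).2 hf
    have hx' := (hB x).2 hx
    refine hxf ?_
    have h3 : ∀ v ∈ kernel u (transpose w (ofMatrix X.bd₂)), vec X.n₁ v ⬝ᵥ f = 0 := by
      intro v hv
      refine Submodule.span_induction (p := fun f _ => vec X.n₁ v ⬝ᵥ f = 0) ?_ (by simp) ?_ ?_ hf'
      · rintro _ ⟨k, hk, rfl⟩
        have := h2 v hv
        rw [List.any_eq_false] at this
        rw [← bit_dot (hlen v hv), bit_eq_zero]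
        simpa using this k hk
      · intro a b _ _ ha hb
        rw [dotProduct_add, ha, hb, add_zero]
      · intro c a _ ha
        rw [dotProduct_smul, ha, smul_zero]
    refine Submodule.span_induction (p := fun x _ => x ⬝ᵥ f = 0) ?_ (by simp) ?_ ?_ hx'
    · rintro _ ⟨v, hv, rfl⟩
      exact h3 v hv
    · intro a b _ _ ha hb
      rw [add_dotProduct, ha, hb, add_zero]
    · intro c a _ ha
      rw [smul_dotProduct, ha, smul_zero]
  · refine ⟨hlen _ h1, (hB _).1 (vec_mem_spanOf h1), ?_⟩
    obtain ⟨k, hk, hd⟩ := List.any_eq_true.1 h2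
    rintro ⟨y, hy⟩
    have h3 : bit (dot (cocycle u w (ofMatrix X.bd₁) (ofMatrix X.bd₂)) k) = 1 :=
      bit_eq_one.2 hd
    have hc : (cocycle u w (ofMatrix X.bd₁) (ofMatrix X.bd₂)).length = X.n₁ := hlen _ h1
    rw [bit_dot hc, ← hy] at h3
    have h4 := (hA _).1 (vec_mem_spanOf hk)
    change X.bd₁.transpose.mulVec y ⬝ᵥ vec X.n₁ k = 1 at h3
    rw [Matrix.mulVec_transpose, ← Matrix.dotProduct_mulVec, h4, dotProduct_zero] at h3
    exact zero_ne_one h3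

end BitList

theorem hammingNorm_add_le {n : ℕ} (v w : Fin n → ZMod 2) :
    hammingNorm (v + w) ≤ hammingNorm v + hammingNorm w := by
  classical
  unfold hammingNorm
  refine (Finset.card_le_card ?_).trans (Finset.card_union_le _ _)
  intro i
  simp only [Finset.mem_filter, Finset.mem_univ, true_and, Finset.mem_union, Pi.add_apply]
  intro h
  by_contra! hc
  simp [hc.1, hc.2] at h

theorem List.countP_ofFn {α : Type*} (p : α → Bool) {n : ℕ} (f : Fin n → α) :
    (List.ofFn f).countP p = (Finset.univ.filter fun i => p (f i) = true).card := by
  induction n with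
  | zero => simp
  | succ n ih =>
    rw [List.ofFn_succ, List.countP_cons, ih, Finset.card_filter, Finset.card_filter,
      Fin.sum_univ_succ, add_comm]

theorem List.countP_le_countP_zipWith_add {α β γ : Type*} (p : α → Bool) (q : γ → Bool)
    (F G : α → β → γ) (l : List α) (m : List β) (hlen : l.length = m.length)
    (h : ∀ a ∈ l, ∀ b ∈ m, p a → q (F a b) ∨ q (G a b)) :
    l.countP p ≤ (List.zipWith F l m).countP q + (List.zipWith G l m).countP q := by
  induction l generalizing m with
  | nil => simp
  | cons a l ih =>
    cases m with
    | nil => simp at hlen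
    | cons b m =>
      have h1 := ih m (by simpa using hlen) fun a ha b hb => h a (by simp [ha]) b (by simp [hb])
      have h2 := h a (by simp) b (by simp)
      simp only [List.zipWith_cons_cons, List.countP_cons]
      cases hp : p a
      · simp; omega
      · rcases h2 hp with h3 | h3 <;> simp [h3] <;> omega

namespace BitList

theorem any_eq_true_iff_count {l : List Bool} : (l.any fun x => x) = true ↔ 0 < l.count true := by
  simp [List.count_pos_iff]

theorem count_dropTrue (l : List Bool) : (dropTrue l).count true = l.count true - 1 := by
  induction l with
  | nil => rfl
  | cons b l ih =>
    rw [dropTrue, List.count_cons, List.count_cons, ih]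
    cases h : l.any fun x => x with
    | true =>
      have := any_eq_true_iff_count.1 h
      cases b
      · simp
      · simp; omega
    | false =>
      have : ¬ 0 < l.count true := fun h' => by simp [any_eq_true_iff_count.2 h'] at h
      cases b <;> simp; omega

/-- The vector has more than three entries `true`. -/
def isLong (c : List Bool) : Bool := (dropTrue (dropTrue (dropTrue c))).any fun x => x

/-- All but the last two entries `true`. -/
def front (c : List Bool) : List Bool := dropTrue (dropTrue c)

/-- The last two entries `true`. -/
def back (c : List Bool) : List Bool := add c (front c)

theorem isLong_iff {c : List Bool} : isLong c = true ↔ 3 < c.count true := by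
  rw [isLong, any_eq_true_iff_count, count_dropTrue, count_dropTrue, count_dropTrue]
  omega

theorem count_front (c : List Bool) : (front c).count true = c.count true - 2 := by
  rw [front, count_dropTrue, count_dropTrue]
  omega

@[simp] theorem length_front (c : List Bool) : (front c).length = c.length := by simp [front]

@[simp] theorem length_back (c : List Bool) : (back c).length = c.length :=
  length_add rfl (length_front c)

theorem count_back_add_count_front (c : List Bool) :
    (back c).count true + (front c).count true = c.count true := by
  induction c with
  | nil => rfl
  | cons b l ih =>
    have h1 : front (b :: l) =
      ((b && l.any fun x => x) && (dropTrue l).any fun x => x) :: front l := rfl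
    have h2 : back (b :: l) = add (b :: l) (front (b :: l)) := rfl
    have h3 : ∀ b' l', add (b :: l) (b' :: l') = (b ^^ b') :: add l l' := fun _ _ => rfl
    have h4 : add l (front l) = back l := rfl
    rw [h2, h1, h3, h4, List.count_cons, List.count_cons, List.count_cons]
    cases b <;> cases l.any fun x => x <;> cases (dropTrue l).any fun x => x <;> simp <;> omega

theorem count_back {c : List Bool} (h : 2 ≤ c.count true) : (back c).count true = 2 := by
  have h1 := count_back_add_count_front c
  have h2 := count_front c
  omega

theorem eval_back_add_eval_front {M : Type*} [AddCommGroup M] [Module (ZMod 2) M]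
    (c : List Bool) (g : ℕ → M) : eval (back c) g + eval (front c) g = eval c g := by
  rw [back, eval_add (by simp), add_assoc, ZModModule.add_self, add_zero]

theorem count_identity {α : Type} (l : List α) : ∀ e ∈ identity l, e.count true = 1 := by
  induction l with
  | nil => simp [identity]
  | cons a l ih =>
    have h : identity (a :: l) =
      (true :: zeros (identity l)) :: (identity l).map (List.cons false) := rfl
    intro e he
    rw [h, List.mem_cons, List.mem_map] at he
    rcases he with rfl | ⟨s, hs, rfl⟩
    · simp [zeros, List.count_eq_zero]
    · simpa using ih s hs

theorem eval_congr {M : Type*} [AddCommMonoid M] (v : List Bool) {g g' : ℕ → M}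
    (h : ∀ i < v.length, g i = g' i) : eval v g = eval v g' := by
  rw [eval_eq_sum v g rfl, eval_eq_sum v g' rfl]
  exact Finset.sum_congr rfl fun i _ => by rw [h i i.2]

theorem hammingNorm_eval_le {n D : ℕ} (v : List Bool) (g : ℕ → Fin n → ZMod 2)
    (h : ∀ i, hammingNorm (g i) ≤ D) : hammingNorm (eval v g) ≤ v.count true * D := by
  induction v generalizing g with
  | nil => simp [eval]
  | cons b l ih =>
    rw [eval, List.count_cons]
    refine (hammingNorm_add_le _ _).trans ?_
    have h1 := ih (fun i => g (i + 1)) fun i => h (i + 1)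
    have h2 := h 0
    cases b
    · simpa using h1
    · simp only [if_true, beq_self_eq_true]
      linarith

end BitList

open BitList

/-- XOR instances as lists: the number of variables in unary and the constraints. -/
abbrev ListXor : Type := List Bool × List (List Bool × Bool)

namespace ListXor

/-- Every constraint is a vector with one entry for each variable. -/
def WellFormed (J : ListXor) : Prop := J.1 = zeros J.1 ∧ ∀ c ∈ J.2, c.1.length = J.1.length

/-- The number of constraints that are violated by `f`. -/
def numUnsat (J : ListXor) (f : ℕ → ZMod 2) : ℕ :=
  J.2.countP fun c => decide (eval c.1 f ≠ bit c.2)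

/-- The part of a split constraint that keeps two variables of a long constraint. -/
def splitBack (c : List Bool × Bool) (e : List Bool) : List Bool × Bool :=
  bif isLong c.1 then (back c.1 ++ e, false) else (c.1 ++ zeros e, c.2)

/-- The part of a split constraint that keeps all but two variables of a long constraint. -/
def splitFront (c : List Bool × Bool) (e : List Bool) : List Bool × Bool :=
  bif isLong c.1 then (front c.1 ++ e, c.2) else (c.1 ++ zeros e, c.2)

/-- Splits each constraint with more than three variables into two, by means of a new variable, and
duplicates the other constraints. -/
def split (J : ListXor) : ListXor :=
  (J.1 ++ zeros J.2,
    List.zipWith splitBack J.2 (identity J.2) ++ List.zipWith splitFront J.2 (identity J.2))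

theorem mem_split {J : ListXor} {c : List Bool × Bool} (hc : c ∈ (split J).2) :
    ∃ (i : ℕ) (hi : i < J.2.length) (hi' : i < (identity J.2).length),
      c = splitBack J.2[i] (identity J.2)[i] ∨ c = splitFront J.2[i] (identity J.2)[i] := by
  rw [split, List.mem_append] at hc
  rcases hc with hc | hc <;>
  · obtain ⟨i, hi, rfl⟩ := List.mem_iff_getElem.1 hc
    rw [List.length_zipWith, length_identity, min_self] at hi
    exact ⟨i, hi, by rwa [length_identity], by simp⟩

theorem length_split_fst (J : ListXor) : (split J).1.length = J.1.length + J.2.length := by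
  simp [split]

theorem length_split_snd (J : ListXor) : (split J).2.length = 2 * J.2.length := by
  simp [split, length_identity]
  omega

theorem WellFormed.split {J : ListXor} (hJ : J.WellFormed) : J.split.WellFormed := by
  refine ⟨?_, ?_⟩
  · have h : ∀ l₁ l₂ : List Bool, zeros (l₁ ++ l₂) = zeros l₁ ++ zeros l₂ := fun l₁ l₂ => by
      simp [zeros]
    have h' : zeros (zeros J.2) = zeros J.2 := by simp [zeros]
    simp only [ListXor.split, h, h', ← hJ.1]
  · intro c hc
    obtain ⟨i, hi, hi', rfl | rfl⟩ := mem_split hc <;>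
    · have h1 := hJ.2 _ (List.getElem_mem hi)
      have h2 := length_of_mem_identity J.2 _ (List.getElem_mem hi')
      rw [length_split_fst]
      cases hl : isLong J.2[i].1 <;> simp [splitBack, splitFront, hl, h1, h2]

theorem le_count_split {J : ListXor} {d : ℕ} (hd : d ≤ 3)
    (h : ∀ c ∈ J.2, d ≤ c.1.count true) : ∀ c ∈ J.split.2, d ≤ c.1.count true := by
  intro c hc
  obtain ⟨i, hi, hi', hc⟩ := mem_split hc
  have h1 := h _ (List.getElem_mem hi)
  have h2 := count_identity J.2 _ (List.getElem_mem hi')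
  have hz : ∀ l : List Bool, (zeros l).count true = 0 := by simp [zeros, List.count_eq_zero]
  unfold splitBack splitFront at hc
  cases hl : isLong J.2[i].1 with
  | true =>
    have h3 := isLong_iff.1 hl
    have h4 := count_front J.2[i].1
    have h5 := count_back (c := J.2[i].1) (by omega)
    rcases hc with rfl | rfl <;> simp [hl] <;> omega
  | false => rcases hc with rfl | rfl <;> simp [hl, hz, h1]

theorem count_split_le {J : ListXor} {d : ℕ}
    (h : ∀ c ∈ J.2, c.1.count true ≤ 3 + (d + 1)) : ∀ c ∈ J.split.2, c.1.count true ≤ 3 + d := by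
  intro c hc
  obtain ⟨i, hi, hi', hc⟩ := mem_split hc
  have h1 := h _ (List.getElem_mem hi)
  have h2 := count_identity J.2 _ (List.getElem_mem hi')
  have hz : ∀ l : List Bool, (zeros l).count true = 0 := by simp [zeros, List.count_eq_zero]
  unfold splitBack splitFront at hc
  cases hl : isLong J.2[i].1 with
  | true =>
    have h3 := isLong_iff.1 hl
    have h4 := count_front J.2[i].1
    have h5 := count_back (c := J.2[i].1) (by omega)
    rcases hc with rfl | rfl <;> simp [hl] <;> omega
  | false =>
    have h3 : ¬ 3 < J.2[i].1.count true := fun h' => by simp [isLong_iff.2 h'] at hl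
    rcases hc with rfl | rfl <;> simp [hl, hz] <;> omega

theorem numUnsat_le_split {J : ListXor} (f : ℕ → ZMod 2) : J.numUnsat f ≤ J.split.numUnsat f := by
  unfold numUnsat split
  rw [List.countP_append]
  refine List.countP_le_countP_zipWith_add _ _ _ _ _ _ (length_identity _).symm ?_
  intro c hc e he h
  have h2 := length_of_mem_identity J.2 _ he
  unfold splitBack splitFront
  cases hl : isLong c.1 with
  | true =>
    by_contra! hcon
    simp only [cond_true, eval_append, length_back, length_front, decide_eq_true_eq, not_not,
      bit_false, ne_eq] at hcon h
    refine h ?_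
    rw [← eval_back_add_eval_front, ← hcon.2,
      show eval (back c.1) f = eval e fun i => f (c.1.length + i) from ?_, add_comm]
    rw [← sub_eq_zero, ← hcon.1, sub_eq_add_neg, ZMod.neg_eq_self_mod_two]
  | false =>
    left
    simpa [hl, eval_append] using h

theorem exists_substitution_split {J : ListXor} (hJ : J.WellFormed) {n D : ℕ}
    (g : ℕ → Fin n → ZMod 2) (hg : ∀ i, hammingNorm (g i) ≤ D)
    (P : (Fin n → ZMod 2) → ZMod 2 → Prop) (h0 : P 0 0)
    (hP : ∀ c ∈ J.2, P (eval c.1 g) (bit c.2)) :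
    ∃ g' : ℕ → Fin n → ZMod 2, (∀ i, hammingNorm (g' i) ≤ 2 * D) ∧
      ∀ c ∈ J.split.2, P (eval c.1 g') (bit c.2) := by
  let g' : ℕ → Fin n → ZMod 2 := fun i =>
    if i < J.1.length then g i else
      if h : i - J.1.length < J.2.length then
        bif isLong J.2[i - J.1.length].1 then eval (back J.2[i - J.1.length].1) g else 0
      else 0
  refine ⟨g', ?_, ?_⟩
  · intro i
    simp only [g']
    split_ifs with h1 h2
    · have := hg i
      omega
    · cases hl : isLong J.2[i - J.1.length].1 with
      | true =>
        have h3 := isLong_iff.1 hl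
        have h4 := hammingNorm_eval_le (back J.2[i - J.1.length].1) g hg
        rwa [count_back (by omega)] at h4
      | false => simp
    · simp
  · intro c hc
    obtain ⟨i, hi, hi', hc⟩ := mem_split hc
    have h1 := hJ.2 _ (List.getElem_mem hi)
    have heval : ∀ v : List Bool, v.length = J.1.length → eval v g' = eval v g := by
      intro v hv
      refine eval_congr v fun j hj => ?_
      simp [g', ← hv, hj]
    have hc' := hP _ (List.getElem_mem hi)
    unfold splitBack splitFront at hc
    cases hl : isLong J.2[i].1 with
    | true =>
      have hnew : g' (J.1.length + i) = eval (back J.2[i].1) g := by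
        simp [g', hi, hl]
      rcases hc with rfl | rfl
      · simp only [hl, cond_true, eval_append, length_back, h1, eval_identity, bit_false]
        rw [heval _ (by simp [h1]), hnew, ZModModule.add_self]
        exact h0
      · simp only [hl, cond_true, eval_append, length_front, h1, eval_identity]
        rw [heval _ (by simp [h1]), hnew, add_comm, eval_back_add_eval_front]
        exact hc'
    | false =>
      rcases hc with rfl | rfl <;>
      · simp only [hl, cond_false, eval_append, eval_zeros, add_zero]
        rwa [heval _ h1]

theorem polyTime_split : PolyTime split := by
  have hJ : PolyTime fun J : ListXor => J.2 := PolyTime.snd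
  have hc : PolyTime fun p : ListXor × (List Bool × Bool) × List Bool => p.2.1 :=
    PolyTime.fst.comp PolyTime.snd
  have hv := PolyTime.fst.comp hc
  have hz := PolyTime.snd.comp hc
  have he : PolyTime fun p : ListXor × (List Bool × Bool) × List Bool => p.2.2 :=
    PolyTime.snd.comp PolyTime.snd
  have hf := hv.bitDropTrue.bitDropTrue
  have hl := hf.bitDropTrue.any (q := fun _ x => x) PolyTime.snd
  have hs := (hv.append he.bitZeros).pair hz
  exact (PolyTime.fst.append hJ.bitZeros).pair
    ((hJ.zipWith (f := fun _ => splitBack) hJ.bitIdentity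
      (hl.cond (((hv.bitAdd hf).append he).pair (PolyTime.const false)) hs)).append
    (hJ.zipWith (f := fun _ => splitFront) hJ.bitIdentity
      (hl.cond ((hf.append he).pair hz) hs)))

/-- The instance on `Fin n` given by lists. -/
def toXor (J : ListXor) : XorInstance where
  n := J.1.length
  m := J.2.length
  T l := Finset.univ.filter fun j => (J.2[(l : ℕ)]).1.getD j false = true
  z l := bit (J.2[(l : ℕ)]).2

theorem mem_toXor_T {J : ListXor} (l : Fin J.toXor.m) (j : Fin J.toXor.n) :
    j ∈ J.toXor.T l ↔ (J.2[(l : ℕ)]'l.2).1.getD j false = true :=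
  Finset.mem_filter_univ j

theorem ofXor_toXor {J : ListXor} (hJ : J.WellFormed) : BinData.ofXor J.toXor = code J := by
  have h1 : BinData.ofNatUnary J.1.length = code J.1 := by
    conv_rhs => rw [hJ.1]
    rw [BinData.ofNatUnary]
    change _ = BinData.ofList _
    congr 1
    simp [zeros, List.map_const']
  rw [BinData.ofXor]
  change BinData.cons (BinData.ofNatUnary J.1.length) _ = .cons (code J.1) (code J.2)
  rw [h1]
  congr 1
  change _ = BinData.ofList (J.2.map code)
  congr 1
  refine List.ext_getElem (by simp [toXor]) fun i h2 h3 => ?_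
  have hi : i < J.2.length := by simpa using h3
  have h4 := hJ.2 _ (List.getElem_mem hi)
  rw [List.getElem_ofFn, List.getElem_map]
  change BinData.cons _ _ = BinData.cons (code J.2[i].1) (code J.2[i].2)
  congr 1
  · change _ = BinData.ofList (J.2[i].1.map code)
    rw [BinData.ofVec]
    congr 1
    refine List.ext_getElem (by simp [toXor, h4]) fun j h5 h6 => ?_
    have hj : j < J.2[i].1.length := by simpa using h6
    rw [List.getElem_ofFn, List.getElem_map]
    change BinData.ofBool _ = BinData.ofBool J.2[i].1[j]
    congr 1
    have h7 : (⟨j, hj.trans_eq h4⟩ : Fin J.toXor.n) ∈ J.toXor.T ⟨i, hi⟩ ↔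
      J.2[i].1.getD j false = true := mem_toXor_T ⟨i, hi⟩ ⟨j, hj.trans_eq h4⟩
    rw [List.getD_eq_getElem _ _ hj] at h7
    split_ifs with h8
    · simpa using (h7.1 h8).symm
    · simpa using (Bool.eq_false_iff.2 (mt h7.2 h8)).symm
  · change BinData.ofBool _ = BinData.ofBool J.2[i].2
    congr 1
    simp [toXor]

theorem card_toXor_T {J : ListXor} (hJ : J.WellFormed) (l : Fin J.toXor.m) :
    (J.toXor.T l).card = (J.2[(l : ℕ)]'l.2).1.count true := by
  have h := hJ.2 _ (List.getElem_mem l.2)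
  generalize hc : (J.2[(l : ℕ)]'l.2).1 = c at h
  have h2 : c = List.ofFn fun j : Fin J.1.length => c.getD j false := by
    refine List.ext_getElem (by simpa using h) fun i h1 h2 => ?_
    rw [List.getElem_ofFn, List.getD_eq_getElem _ _ h1]
  rw [List.count, h2, List.countP_ofFn]
  congr 1
  ext j
  rw [mem_toXor_T, hc]
  simp only [beq_true]
  exact (Finset.mem_filter_univ (p := fun j : Fin J.1.length => c.getD j false = true) j).symm

theorem sum_toXor_T {M : Type*} [AddCommMonoid M] {J : ListXor} (hJ : J.WellFormed)
    (l : Fin J.toXor.m) (g : ℕ → M) :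
    ∑ j ∈ J.toXor.T l, g j = eval (J.2[(l : ℕ)]'l.2).1 g := by
  rw [eval_eq_sum _ g (hJ.2 _ (List.getElem_mem l.2))]
  exact Finset.sum_filter _ _

theorem numSat_toXor_add {J : ListXor} (hJ : J.WellFormed) (f : ℕ → ZMod 2) :
    J.toXor.numSat (fun j => f j) + J.numUnsat f = J.2.length := by
  have h1 : J.numUnsat f =
      (Finset.univ.filter fun l : Fin J.toXor.m =>
        ¬ ∑ j ∈ J.toXor.T l, f j = J.toXor.z l).card := by
    have h2 : J.2 = List.ofFn fun l : Fin J.toXor.m => J.2[(l : ℕ)]'l.2 := by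
      refine List.ext_getElem (by simp [toXor]) fun i h1 h2 => ?_
      rw [List.getElem_ofFn]
      rfl
    rw [numUnsat]
    conv_lhs => rw [h2]
    rw [List.countP_ofFn]
    simp only [sum_toXor_T hJ, decide_eq_true_eq]
    rfl
  rw [h1, XorInstance.numSat, Finset.card_filter_add_card_filter_not, Finset.card_univ,
    Fintype.card_fin]
  rfl

end ListXor

/-! ### Vectors for the Sum-of-Squares relaxation -/

/-- The sign `(-1)^z`. -/
noncomputable def bitSign (z : ZMod 2) : ℝ := (-1) ^ z.val

theorem bitSign_add (a b : ZMod 2) : bitSign (a + b) = bitSign a * bitSign b := by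
  have h : ∀ a : ZMod 2, a = 0 ∨ a = 1 := by decide
  have h1 : (1 + 1 : ZMod 2).val = 0 := rfl
  rcases h a with rfl | rfl <;> rcases h b with rfl | rfl <;> simp [bitSign, ZMod.val_one, h1]

theorem bitSign_mul_self (a : ZMod 2) : bitSign a * bitSign a = 1 := by
  rw [← bitSign_add, ZModModule.add_self]
  simp [bitSign]

theorem abs_bitSign (a : ZMod 2) : |bitSign a| = 1 := by simp [bitSign]

theorem XorInstance.exists_sosFeasible {V : Type*} [AddCommGroup V] [Module (ZMod 2) V] {n : ℕ}
    (φ : Finset (Fin n) → V) (hφ : ∀ S S', φ (symmDiff S S') = φ S + φ S') (t : ℕ)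
    (R : V → ZMod 2 → Prop) (hzero : R 0 0) (hunique : ∀ u z z', R u z → R u z' → z = z')
    (hadd : ∀ S S' S'' z z', S.card ≤ t → S'.card ≤ t → S''.card ≤ t →
      R (φ S + φ S') z → R (φ S' + φ S'') z' → R (φ S + φ S'') (z + z')) :
    ∃ (d : ℕ) (v : Finset (Fin n) → EuclideanSpace ℝ (Fin d)), SoSFeasible t v ∧
      ∀ S S' z, S.card ≤ t → S'.card ≤ t → R (φ S + φ S') z →
        inner ℝ (v S) (v S') = bitSign z := by
  classical
  let r : Setoid {S : Finset (Fin n) // S.card ≤ t} :=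
    { r := fun S S' => ∃ z, R (φ S + φ S') z
      iseqv :=
        { refl := fun S => ⟨0, by rwa [ZModModule.add_self]⟩
          symm := fun {S S'} ⟨z, h⟩ => ⟨z, by rwa [add_comm]⟩
          trans := fun {S S' S''} ⟨z, h⟩ ⟨z', h'⟩ =>
            ⟨z + z', hadd S S' S'' z z' S.2 S'.2 S''.2 h h'⟩ } }
  let rep : {S : Finset (Fin n) // S.card ≤ t} → {S : Finset (Fin n) // S.card ≤ t} :=
    fun S => (Quotient.mk r S).out
  have hrep : ∀ S : {S : Finset (Fin n) // S.card ≤ t}, ∃ z, R (φ S + φ (rep S)) z := fun S =>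
    r.symm (Quotient.mk_out (s := r) S)
  have hrep_eq : ∀ S S' : {S : Finset (Fin n) // S.card ≤ t},
      (∃ z, R (φ S + φ S') z) ↔ rep S = rep S' := by
    intro S S'
    constructor
    · intro h
      exact congrArg Quotient.out (Quotient.sound (s := r) h)
    · intro h
      exact Quotient.exact (s := r) (Quotient.out_injective h)
  choose s hs using hrep
  let e := Fintype.equivFin {S : Finset (Fin n) // S.card ≤ t}
  let v : Finset (Fin n) → EuclideanSpace ℝ
      (Fin (Fintype.card {S : Finset (Fin n) // S.card ≤ t})) := fun S =>
    if h : S.card ≤ t then bitSign (s ⟨S, h⟩) • EuclideanSpace.single (e (rep ⟨S, h⟩)) 1 else 0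
  have hinner : ∀ S S' z, S.card ≤ t → S'.card ≤ t → R (φ S + φ S') z →
      inner ℝ (v S) (v S') = bitSign z := by
    intro S S' z h h' hz
    have h1 := (hrep_eq ⟨S, h⟩ ⟨S', h'⟩).1 ⟨z, hz⟩
    have h2 := hs ⟨S, h⟩
    have h3 := hs ⟨S', h'⟩
    rw [← h1, add_comm] at h3
    have h4 := hadd _ _ _ _ _ h (rep ⟨S, h⟩).2 h' h2 h3
    rw [hunique _ _ _ hz h4, bitSign_add]
    simp only [v, h, h', dif_pos, ← h1, inner_smul_left, inner_smul_right]
    simp [mul_comm]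
  have hinner' : ∀ S S', S.card ≤ t → S'.card ≤ t → (¬ ∃ z, R (φ S + φ S') z) →
      inner ℝ (v S) (v S') = 0 := by
    intro S S' h h' hz
    have h1 := mt (hrep_eq ⟨S, h⟩ ⟨S', h'⟩).2 hz
    simp only [v, h, h', dif_pos, inner_smul_left, inner_smul_right]
    rw [EuclideanSpace.inner_single_left]
    simp [h1]
  refine ⟨_, v, ⟨?_, ?_⟩, hinner⟩
  · intro S₁ S₂ S₃ S₄ h₁ h₂ h₃ h₄ h
    have h5 : φ S₁ + φ S₂ = φ S₃ + φ S₄ := by rw [← hφ, ← hφ, h]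
    by_cases hz : ∃ z, R (φ S₁ + φ S₂) z
    · obtain ⟨z, hz⟩ := hz
      rw [hinner _ _ z h₁ h₂ hz, hinner _ _ z h₃ h₄ (h5 ▸ hz)]
    · rw [hinner' _ _ h₁ h₂ hz, hinner' _ _ h₃ h₄ (h5 ▸ hz)]
  · intro S h
    simp only [v, h, dif_pos, norm_smul, Real.norm_eq_abs, abs_bitSign]
    simp

theorem XorInstance.sosObjective_le_one (I : XorInstance) {t d : ℕ} (hI : I.IsMaxXor t)
    {v : Finset (Fin I.n) → EuclideanSpace ℝ (Fin d)} (hv : SoSFeasible t v) :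
    I.sosObjective v ≤ 1 := by
  have h1 : ∑ i, (-1 : ℝ) ^ (I.z i).val * inner ℝ (v (I.T i)) (v ∅) ≤ I.m := by
    calc _ ≤ ∑ i : Fin I.m, (1 : ℝ) := by
          refine Finset.sum_le_sum fun i _ => ?_
          refine (le_abs_self _).trans ?_
          rw [abs_mul]
          have h2 := abs_real_inner_le_norm (v (I.T i)) (v ∅)
          rw [hv.2 _ (hI i), hv.2 ∅ (by simp)] at h2
          simpa using h2
      _ = I.m := by simp
  rw [sosObjective]
  rcases Nat.eq_zero_or_pos I.m with h | h
  · rw [show 1 / (2 * (I.m : ℝ)) = 0 by simp [h]]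
    norm_num
  · have h' : (0 : ℝ) < I.m := by exact_mod_cast h
    have : 1 / (2 * (I.m : ℝ)) * ∑ i, (-1 : ℝ) ^ (I.z i).val * inner ℝ (v (I.T i)) (v ∅) ≤
        1 / (2 * (I.m : ℝ)) * I.m := by gcongr
    have h3 : 1 / (2 * (I.m : ℝ)) * I.m = 1 / 2 := by field_simp
    linarith

theorem XorInstance.hasSoSValue_one (I : XorInstance) {t d : ℕ} (hI : I.IsMaxXor t) (hm : 0 < I.m)
    {v : Finset (Fin I.n) → EuclideanSpace ℝ (Fin d)} (hv : SoSFeasible t v)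
    (h : ∀ i, inner ℝ (v (I.T i)) (v ∅) = bitSign (I.z i)) : I.HasSoSValue t 1 := by
  refine ⟨⟨d, v, hv, ?_⟩, ?_⟩
  · have h' : (0 : ℝ) < I.m := by exact_mod_cast hm
    have h2 : ∑ i, (-1 : ℝ) ^ (I.z i).val * inner ℝ (v (I.T i)) (v ∅) = I.m := by
      simp only [h]
      calc _ = ∑ i : Fin I.m, (1 : ℝ) := Finset.sum_congr rfl fun i _ => bitSign_mul_self _
        _ = I.m := by simp
    rw [sosObjective, h2]
    field_simp
    norm_num
  · rintro _ ⟨d', v', hv', rfl⟩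
    exact I.sosObjective_le_one hI hv'

/-! ### Derivations from chains of small weight -/

namespace F2Complex

/-- The constraint `u = z` is the sum of at most `w` constraints `δ₀ = β`. -/
def Derives (X : F2Complex) (β : Fin X.n₁ → ZMod 2) (w : ℝ) (u : Fin X.n₀ → ZMod 2)
    (z : ZMod 2) : Prop :=
  ∃ f : Fin X.n₁ → ZMod 2, (hammingNorm f : ℝ) ≤ w ∧ X.boundary₁ f = u ∧ β ⬝ᵥ f = z

theorem dotProduct_boundary (X : F2Complex) {β b : Fin X.n₁ → ZMod 2} (hβ : β ∈ X.cocycles)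
    (hb : b ∈ X.boundaries) : β ⬝ᵥ b = 0 := by
  obtain ⟨c, rfl⟩ := hb
  have h : X.bd₂.transpose.mulVec β = 0 := hβ
  change β ⬝ᵥ X.bd₂.mulVec c = 0
  rw [Matrix.dotProduct_mulVec, ← Matrix.mulVec_transpose, h, zero_dotProduct]

theorem boundary₁_of_mem_boundaries (X : F2Complex) {b : Fin X.n₁ → ZMod 2}
    (hb : b ∈ X.boundaries) : X.boundary₁ b = 0 := by
  obtain ⟨c, rfl⟩ := hb
  change X.bd₁.mulVec (X.bd₂.mulVec c) = 0
  rw [Matrix.mulVec_mulVec, X.bd₁_mul_bd₂, Matrix.zero_mulVec]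

theorem exists_boundary_hammingNorm_eq (X : F2Complex) (f : Fin X.n₁ → ZMod 2) :
    ∃ b ∈ X.boundaries, hammingNorm (f + b) = X.distBoundaries f := by
  obtain ⟨b, hb⟩ := Nat.sInf_mem (Set.range_nonempty
    fun b : X.boundaries => hammingNorm (f + (b : Fin X.n₁ → ZMod 2)))
  exact ⟨b, b.2, hb⟩

variable {X : F2Complex} {β : Fin X.n₁ → ZMod 2} {w ρ₁ ρ₂ : ℝ}

/-- A chain of weight at most `2w` whose boundary is small can be replaced by a chain of
weight at most `w`. -/
theorem derives_of_boundary (hβ : β ∈ X.cocycles) (hX : X.SmallSetBoundaryExpander ρ₁ ρ₂)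
    (hρ₂ : 0 < ρ₂) (hw₀ : 0 ≤ w) (hw : 2 * w ≤ ρ₁ * X.n₁) {f : Fin X.n₁ → ZMod 2}
    (hf : (hammingNorm f : ℝ) ≤ 2 * w) (hu : (hammingNorm (X.boundary₁ f) : ℝ) ≤ ρ₂ * w) :
    X.Derives β w (X.boundary₁ f) (β ⬝ᵥ f) := by
  by_cases hb : f ∈ X.boundaries
  · exact ⟨0, by simpa using hw₀, by simp [X.boundary₁_of_mem_boundaries hb],
      by simp [X.dotProduct_boundary hβ hb]⟩
  · have h1 := hX f hb (hf.trans hw)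
    obtain ⟨b, hbb, hd⟩ := X.exists_boundary_hammingNorm_eq f
    refine ⟨f + b, ?_, by simp [X.boundary₁_of_mem_boundaries hbb],
      by simp [dotProduct_add, X.dotProduct_boundary hβ hbb]⟩
    rw [hd]
    exact le_of_mul_le_mul_left (h1.trans hu) hρ₂

theorem Derives.unique (hβ : β ∈ X.cocycles) (hX : X.SmallSetBoundaryExpander ρ₁ ρ₂)
    (hρ₂ : 0 < ρ₂) (hw : 2 * w ≤ ρ₁ * X.n₁) {u : Fin X.n₀ → ZMod 2} {z z' : ZMod 2}
    (h : X.Derives β w u z) (h' : X.Derives β w u z') : z = z' := by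
  obtain ⟨f, hf, hfu, rfl⟩ := h
  obtain ⟨f', hf', hfu', rfl⟩ := h'
  have hbd : X.boundary₁ (f + f') = 0 := by rw [map_add, hfu, hfu', ZModModule.add_self]
  have hmem : f + f' ∈ X.boundaries := by
    by_contra hb
    have hsum : (hammingNorm (f + f') : ℝ) ≤ hammingNorm f + hammingNorm f' := by
      exact_mod_cast hammingNorm_add_le f f'
    have h1 := hX _ hb (by linarith)
    rw [hbd, hammingNorm_zero, Nat.cast_zero] at h1
    obtain ⟨b, hbb, hd⟩ := X.exists_boundary_hammingNorm_eq (f + f')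
    have h2 : X.distBoundaries (f + f') = 0 := by
      by_contra h0
      have : (0 : ℝ) < X.distBoundaries (f + f') := by exact_mod_cast Nat.pos_of_ne_zero h0
      nlinarith
    rw [h2, hammingNorm_eq_zero, add_eq_zero_iff_eq_neg] at hd
    exact hb (hd ▸ neg_mem hbb)
  have h3 := X.dotProduct_boundary hβ hmem
  rw [dotProduct_add, add_eq_zero_iff_eq_neg, ZMod.neg_eq_self_mod_two] at h3
  exact h3

theorem Derives.add (hβ : β ∈ X.cocycles) (hX : X.SmallSetBoundaryExpander ρ₁ ρ₂)
    (hρ₂ : 0 < ρ₂) (hw₀ : 0 ≤ w) (hw : 2 * w ≤ ρ₁ * X.n₁) {u u' : Fin X.n₀ → ZMod 2}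
    {z z' : ZMod 2} (h : X.Derives β w u z) (h' : X.Derives β w u' z')
    (hu : (hammingNorm (u + u') : ℝ) ≤ ρ₂ * w) : X.Derives β w (u + u') (z + z') := by
  obtain ⟨f, hf, rfl, rfl⟩ := h
  obtain ⟨f', hf', rfl, rfl⟩ := h'
  rw [← map_add] at hu ⊢
  rw [← dotProduct_add]
  have hsum : (hammingNorm (f + f') : ℝ) ≤ hammingNorm f + hammingNorm f' := by
    exact_mod_cast hammingNorm_add_le f f'
  exact derives_of_boundary hβ hX hρ₂ hw₀ hw (by linarith) hu

end F2Complex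

theorem hammingNorm_sum_le {ι : Type*} {n D : ℕ} (S : Finset ι) (g : ι → Fin n → ZMod 2)
    (hg : ∀ i, hammingNorm (g i) ≤ D) : hammingNorm (∑ i ∈ S, g i) ≤ S.card * D := by
  classical
  induction S using Finset.induction_on with
  | empty => simp
  | insert i S hi ih =>
    rw [Finset.sum_insert hi, Finset.card_insert_of_notMem hi]
    have := hammingNorm_add_le (g i) (∑ i ∈ S, g i)
    have := hg i
    linarith

theorem sum_symmDiff {ι V : Type*} [DecidableEq ι] [AddCommGroup V] [Module (ZMod 2) V]
    (S S' : Finset ι) (g : ι → V) :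
    ∑ i ∈ symmDiff S S', g i = ∑ i ∈ S, g i + ∑ i ∈ S', g i := by
  have h1 : symmDiff S S' = (S \ S') ∪ (S' \ S) := rfl
  rw [h1, Finset.sum_union (disjoint_sdiff_sdiff), ← Finset.sum_inter_add_sum_sdiff S S' g,
    ← Finset.sum_inter_add_sum_sdiff S' S g, Finset.inter_comm S' S, add_add_add_comm,
    ZModModule.add_self, zero_add]

/-- An instance whose variables can be replaced by linear forms of bounded weight so that each
constraint becomes a combination of at most one constraint of `δ₀ = β` is not refuted. -/
theorem XorInstance.notRefuted_of_derives {X : F2Complex} {β : Fin X.n₁ → ZMod 2} {w ρ₁ ρ₂ : ℝ}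
    (hβ : β ∈ X.cocycles) (hX : X.SmallSetBoundaryExpander ρ₁ ρ₂) (hρ₂ : 0 < ρ₂) (hw₁ : 1 ≤ w)
    (hw : 2 * w ≤ ρ₁ * X.n₁) (I : XorInstance) (hm : 0 < I.m)
    (g : Fin I.n → Fin X.n₀ → ZMod 2) {D t : ℕ} (hg : ∀ i, hammingNorm (g i) ≤ D)
    (ht : 2 * (t * D : ℝ) ≤ ρ₂ * w)
    (hI : ∀ l, X.Derives β 1 (∑ j ∈ I.T l, g j) (I.z l)) : I.NotRefuted t := by
  intro hIt
  have hw₀ : 0 ≤ w := zero_le_one.trans hw₁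
  have hweight : ∀ S S' : Finset (Fin I.n), S.card ≤ t → S'.card ≤ t →
      (hammingNorm (∑ i ∈ S, g i + ∑ i ∈ S', g i) : ℝ) ≤ ρ₂ * w := by
    intro S S' h h'
    refine le_trans ?_ ht
    have h1 := hammingNorm_add_le (∑ i ∈ S, g i) (∑ i ∈ S', g i)
    have h2 := (hammingNorm_sum_le S g hg).trans (Nat.mul_le_mul_right D h)
    have h3 := (hammingNorm_sum_le S' g hg).trans (Nat.mul_le_mul_right D h')
    have h4 : hammingNorm (∑ i ∈ S, g i + ∑ i ∈ S', g i) ≤ 2 * (t * D) := by omega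
    exact_mod_cast h4
  obtain ⟨d, v, hv, hinner⟩ := XorInstance.exists_sosFeasible (fun S => ∑ i ∈ S, g i)
    (fun S S' => sum_symmDiff S S' g) t (X.Derives β w)
    ⟨0, by simpa using hw₀, by simp, by simp⟩
    (fun u z z' h h' => h.unique hβ hX hρ₂ hw h')
    (by
      intro S S' S'' z z' h h' h'' hz hz'
      have h1 : ∑ i ∈ S, g i + ∑ i ∈ S'', g i =
          (∑ i ∈ S, g i + ∑ i ∈ S', g i) + (∑ i ∈ S', g i + ∑ i ∈ S'', g i) := by
        rw [add_assoc, ← add_assoc (∑ i ∈ S', g i), ZModModule.add_self, zero_add]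
      have h2 := hweight S S'' h h''
      rw [h1] at h2 ⊢
      exact hz.add hβ hX hρ₂ hw₀ hw hz' h2)
  refine I.hasSoSValue_one hIt hm hv fun l => hinner _ _ _ (hIt l) (by simp) ?_
  obtain ⟨f, hf, hfu, hfz⟩ := hI l
  exact ⟨f, hf.trans hw₁, by simpa using hfu, hfz⟩

/-! ### The instance of a chain complex -/

namespace ListXor

theorem polyTime_iterate_split (r : ℕ) : PolyTime split^[r] := by
  induction r with
  | zero => exact PolyTime.id
  | succ r ih => exact ih.comp polyTime_split

theorem WellFormed.iterate_split {J : ListXor} (hJ : J.WellFormed) (r : ℕ) :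
    WellFormed (ListXor.split^[r] J) := by
  induction r generalizing J with
  | zero => exact hJ
  | succ r ih => exact ih hJ.split

theorem length_iterate_split_snd (J : ListXor) (r : ℕ) :
    (split^[r] J).2.length = 2 ^ r * J.2.length := by
  induction r generalizing J with
  | zero => simp
  | succ r ih => rw [Function.iterate_succ_apply, ih, length_split_snd]; ring

theorem length_iterate_split_fst (J : ListXor) (r : ℕ) :
    (split^[r] J).1.length + J.2.length = J.1.length + 2 ^ r * J.2.length := by
  induction r generalizing J with
  | zero => simp
  | succ r ih =>
    have h := ih J.split
    rw [length_split_fst, length_split_snd] at h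
    rw [Function.iterate_succ_apply, pow_succ]
    linarith

theorem le_count_iterate_split {J : ListXor} {d : ℕ} (hd : d ≤ 3)
    (h : ∀ c ∈ J.2, d ≤ c.1.count true) (r : ℕ) :
    ∀ c ∈ (split^[r] J).2, d ≤ c.1.count true := by
  induction r generalizing J with
  | zero => exact h
  | succ r ih => exact ih (le_count_split hd h)

theorem count_iterate_split_le {J : ListXor} {r : ℕ} (h : ∀ c ∈ J.2, c.1.count true ≤ 3 + r) :
    ∀ c ∈ (split^[r] J).2, c.1.count true ≤ 3 := by
  induction r generalizing J with
  | zero => exact h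
  | succ r ih => exact ih (count_split_le h)

theorem numUnsat_le_iterate_split (J : ListXor) (f : ℕ → ZMod 2) (r : ℕ) :
    J.numUnsat f ≤ numUnsat (split^[r] J) f := by
  induction r generalizing J with
  | zero => exact le_rfl
  | succ r ih => exact (numUnsat_le_split f).trans (ih J.split)

theorem exists_substitution_iterate_split {J : ListXor} (hJ : J.WellFormed) {n D : ℕ}
    (g : ℕ → Fin n → ZMod 2) (hg : ∀ i, hammingNorm (g i) ≤ D)
    (P : (Fin n → ZMod 2) → ZMod 2 → Prop) (h0 : P 0 0)
    (hP : ∀ c ∈ J.2, P (eval c.1 g) (bit c.2)) (r : ℕ) :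
    ∃ g' : ℕ → Fin n → ZMod 2, (∀ i, hammingNorm (g' i) ≤ 2 ^ r * D) ∧
      ∀ c ∈ (split^[r] J).2, P (eval c.1 g') (bit c.2) := by
  induction r generalizing J g D with
  | zero => exact ⟨g, by simpa using hg, hP⟩
  | succ r ih =>
    obtain ⟨g₁, hg₁, hP₁⟩ := exists_substitution_split hJ g hg P h0 hP
    obtain ⟨g₂, hg₂, hP₂⟩ := ih hJ.split g₁ hg₁ hP₁
    exact ⟨g₂, fun i => (hg₂ i).trans_eq (by ring), hP₂⟩

end ListXor

/-- Chain complexes as lists: the sizes in unary and the matrices. -/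
abbrev ListComplex : Type :=
  List Bool × List Bool × List Bool × List (List Bool) × List (List Bool) × Unit

/-- The lists that describe a chain complex. -/
def F2Complex.toLists (X : F2Complex) : ListComplex :=
  (List.replicate X.n₀ false, List.replicate X.n₁ false, List.replicate X.n₂ false,
    BitList.ofMatrix X.bd₁, BitList.ofMatrix X.bd₂, ())

theorem F2Complex.code_toLists (X : F2Complex) : code X.toLists = BinData.ofComplex X := by
  have h1 : ∀ n : ℕ, code (List.replicate n false) = BinData.ofNatUnary n := by
    intro n
    change BinData.ofList _ = BinData.ofList _
    simp
  have h2 : ∀ {m n : ℕ} (M : Matrix (Fin m) (Fin n) (ZMod 2)),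
      code (BitList.ofMatrix M) = BinData.ofMatrix M := by
    intro m n M
    change BinData.ofList _ = BinData.ofList _
    rw [BitList.ofMatrix, List.map_ofFn]
    congr 1
    refine congrArg List.ofFn (funext fun x => ?_)
    change BinData.ofList _ = BinData.ofList _
    rw [List.map_ofFn]
    rfl
  simp only [F2Complex.toLists, code_pair, h1, h2]
  rfl

namespace ListXor

/-- The constraints `δ₀ = β` for a co-cycle `β` that is not a co-boundary. -/
def ofListComplex (x : ListComplex) : ListXor :=
  (x.1, List.zipWith Prod.mk (transpose x.2.1 x.2.2.2.1)
    (cocycle x.2.1 x.2.2.1 x.2.2.2.1 x.2.2.2.2.1))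

theorem polyTime_ofListComplex : PolyTime ofListComplex := by
  have h0 : PolyTime fun x : ListComplex => x.2 := PolyTime.snd
  have hu := PolyTime.fst.comp h0
  have h1 := PolyTime.snd.comp h0
  have hw := PolyTime.fst.comp h1
  have h2 := PolyTime.snd.comp h1
  have hA := PolyTime.fst.comp h2
  have hB := PolyTime.fst.comp (PolyTime.snd.comp h2)
  have hK := hu.bitKernel hA
  have hL := hu.bitKernel (hw.bitTranspose hB)
  have hq : PolyTime fun p : ListComplex × List Bool =>
      (kernel p.1.2.1 p.1.2.2.2.1).any (dot p.2) :=
    (hK.comp PolyTime.fst).any (q := fun p => dot p.2)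
      ((PolyTime.snd.comp PolyTime.fst).bitDot PolyTime.snd)
  have hβ : PolyTime fun x : ListComplex =>
      pick (fun v => (kernel x.2.1 x.2.2.2.1).any (dot v))
        (kernel x.2.1 (transpose x.2.2.1 x.2.2.2.2.1)) :=
    hL.bitPick (q := fun x v => (kernel x.2.1 x.2.2.2.1).any (dot v)) hq
  exact PolyTime.fst.pair ((hu.bitTranspose hA).zipWith (f := fun _ => Prod.mk) hβ PolyTime.snd)

/-- The list form of the instance `δ₀ = β` of a chain complex. -/
def ofComplex (X : F2Complex) : ListXor := ofListComplex X.toLists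

/-- The right-hand side of the instance of a chain complex. -/
def rhs (X : F2Complex) : List Bool :=
  cocycle (List.replicate X.n₁ false) (List.replicate X.n₂ false) (BitList.ofMatrix X.bd₁)
    (BitList.ofMatrix X.bd₂)

variable {X : F2Complex}

theorem rhs_spec (hX : Nontrivial X.Cohomology) : (rhs X).length = X.n₁ ∧
    vec X.n₁ (rhs X) ∈ X.cocycles ∧ vec X.n₁ (rhs X) ∉ X.coboundaries :=
  cocycle_spec X hX _ (by simp) _ (by simp)

theorem ofComplex_snd (hX : Nontrivial X.Cohomology) :
    (ofComplex X).2 = List.ofFn fun y : Fin X.n₁ =>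
      (List.ofFn fun x => decide (X.bd₁ x y = 1), (rhs X).getD y false) := by
  have h1 : (ofComplex X).2 = List.zipWith Prod.mk
      (transpose (List.replicate X.n₁ false) (BitList.ofMatrix X.bd₁)) (rhs X) := rfl
  rw [h1, transpose_ofMatrix _ (by simp)]
  have h2 := (rhs_spec hX).1
  refine List.ext_getElem (by simp [BitList.ofMatrix, h2]) fun i h3 h4 => ?_
  have hi : i < (rhs X).length := by simpa [h2] using h4
  simp only [List.getElem_zipWith, List.getElem_ofFn, List.getD_eq_getElem _ _ hi,
    BitList.ofMatrix]
  rfl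

theorem length_ofComplex_fst (X : F2Complex) : (ofComplex X).1.length = X.n₀ :=
  List.length_replicate

theorem length_ofComplex_snd (hX : Nontrivial X.Cohomology) :
    (ofComplex X).2.length = X.n₁ := by simp [ofComplex_snd hX]

theorem wellFormed_ofComplex (hX : Nontrivial X.Cohomology) : (ofComplex X).WellFormed := by
  refine ⟨?_, ?_⟩
  · change List.replicate X.n₀ false = zeros (List.replicate X.n₀ false)
    simp [zeros]
  · rw [ofComplex_snd hX, length_ofComplex_fst]
    simp [List.mem_ofFn']

theorem count_ofFn_decide {n : ℕ} (f : Fin n → ZMod 2) :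
    (List.ofFn fun x => decide (f x = 1)).count true = hammingNorm f := by
  have h : ∀ a : ZMod 2, a = 1 ↔ a ≠ 0 := by decide
  rw [List.count, List.countP_ofFn, hammingNorm]
  simp [h]

theorem exists_of_mem_ofComplex (hX : Nontrivial X.Cohomology) {c : List Bool × Bool}
    (hc : c ∈ (ofComplex X).2) : ∃ y, c =
      (List.ofFn fun x => decide (X.bd₁ x y = 1), (rhs X).getD y false) := by
  rw [ofComplex_snd hX, List.mem_ofFn'] at hc
  obtain ⟨y, rfl⟩ := hc
  exact ⟨y, rfl⟩

theorem numUnsat_ofComplex (hX : Nontrivial X.Cohomology) (f : ℕ → ZMod 2) :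
    (ofComplex X).numUnsat f =
      hammingNorm (X.coboundary₀ (fun x => f x) + vec X.n₁ (rhs X)) := by
  have h : ∀ a b : ZMod 2, a ≠ b ↔ a + b ≠ 0 := by decide
  have h' : ∀ a : ZMod 2, (a = 1 ∧ a ≠ 0) ∨ (a ≠ 1 ∧ a = 0) := by decide
  rw [numUnsat, ofComplex_snd hX, List.countP_ofFn, hammingNorm]
  congr 1
  refine Finset.filter_congr fun y _ => ?_
  rw [decide_eq_true_eq, h, Pi.add_apply]
  have h2 : eval (List.ofFn fun x => decide (X.bd₁ x y = 1)) f =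
      X.coboundary₀ (fun x => f x) y := by
    rw [eval_eq_sum (n := X.n₀) _ _ (by simp)]
    change _ = ∑ x, X.bd₁ x y * f x
    refine Finset.sum_congr rfl fun x _ => ?_
    rcases h' (X.bd₁ x y) with h3 | h3 <;> simp [h3]
  rw [h2]
  rfl

theorem lt_numUnsat_ofComplex {μ : ℝ} (hX : Nontrivial X.Cohomology)
    (hμ : X.HasCosystolicDistance μ) (f : ℕ → ZMod 2) :
    μ * X.n₁ < (ofComplex X).numUnsat f := by
  obtain ⟨-, h1, h2⟩ := rhs_spec hX
  rw [numUnsat_ofComplex hX]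
  have h3 : X.coboundary₀ (fun x => f x) ∈ X.coboundaries := ⟨_, rfl⟩
  refine hμ _ (add_mem ?_ h1) fun h => h2 ((add_mem_cancel_left h3).1 h)
  change X.bd₂.transpose.mulVec (X.bd₁.transpose.mulVec _) = 0
  rw [Matrix.mulVec_mulVec, ← Matrix.transpose_mul, X.bd₁_mul_bd₂, Matrix.transpose_zero,
    Matrix.zero_mulVec]

theorem derives_ofComplex (hX : Nontrivial X.Cohomology) :
    ∀ c ∈ (ofComplex X).2, X.Derives (vec X.n₁ (rhs X)) 1 (eval c.1 (basisVec X.n₀)) (bit c.2) := by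
  intro c hc
  obtain ⟨y, rfl⟩ := exists_of_mem_ofComplex hX hc
  refine ⟨Pi.single y 1, ?_, ?_, ?_⟩
  · have h : hammingNorm (Pi.single y 1 : Fin X.n₁ → ZMod 2) ≤ 1 := by
      rw [hammingNorm, Finset.card_le_one]
      intro a ha b hb
      simp only [Finset.mem_filter, Pi.single_apply] at ha hb
      simp_all
    exact_mod_cast h
  · rw [eval_basisVec _ (by simp), vec_ofFn (fun x => X.bd₁ x y)]
    exact X.bd₁.mulVec_single_one y
  · simp [vec]

theorem hammingNorm_basisVec_le (n i : ℕ) : hammingNorm (basisVec n i) ≤ 1 := by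
  rw [hammingNorm, Finset.card_le_one]
  intro a ha b hb
  unfold basisVec at ha hb
  split_ifs at ha hb with h
  · simp only [Finset.mem_filter, Pi.single_apply] at ha hb
    simp_all
  · simp at ha

end ListXor

theorem card_le_mul_of_hammingNorm {m n k : ℕ} (M : Matrix (Fin m) (Fin n) (ZMod 2))
    (hcol : ∀ y, 1 ≤ hammingNorm fun x => M x y) (hrow : ∀ x, hammingNorm (fun y => M x y) ≤ k) :
    n ≤ k * m := by
  calc n = ∑ y : Fin n, 1 := by simp
    _ ≤ ∑ y, hammingNorm fun x => M x y := Finset.sum_le_sum fun y _ => hcol y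
    _ = ∑ x, hammingNorm fun y => M x y := by
      simp only [hammingNorm, Finset.card_filter]
      exact Finset.sum_comm
    _ ≤ ∑ x : Fin m, k := Finset.sum_le_sum fun x _ => hrow x
    _ = k * m := by simp [mul_comm]

/-- The instance of a chain complex, with its constraints split `r` times. -/
def F2Complex.xorInstance (X : F2Complex) (r : ℕ) : XorInstance :=
  ListXor.toXor (ListXor.split^[r] (ListXor.ofComplex X))

open ListXor in
theorem explicitInstances_xorInstance {X : ℕ → F2Complex} {k : ℕ} (r : ℕ)
    (hX : ExplicitComplexes X) (hdeg : ∀ i, (X i).Nondegenerate ∧ (X i).MaxDegreeLE k)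
    (hH : ∀ i, Nontrivial (X i).Cohomology) :
    ExplicitInstances fun i => (X i).xorInstance r := by
  obtain ⟨p, P, hp⟩ := hX
  obtain ⟨q, Q, hq⟩ := (polyTime_iterate_split r).comp polyTime_ofListComplex
  let P' : Polynomial ℕ := P.comp (.C (1 + k + k * k) * .X)
  refine ⟨.comp q p, P' + Q.comp P' + 1, fun i => ?_⟩
  obtain ⟨c, hc, hr⟩ := hp i
  obtain ⟨d, hd, hr'⟩ := hq (X i).toLists
  rw [F2Complex.code_toLists] at hr'
  have hcode := ofXor_toXor (WellFormed.iterate_split (wellFormed_ofComplex (hH i)) r)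
  change q.Runs _ (code (split^[r] (ofComplex (X i)))) d at hr'
  rw [← hcode] at hr'
  refine ⟨_, ?_, .comp hr hr'⟩
  have hn : (X i).n₀ ≤ (split^[r] (ofComplex (X i))).1.length := by
    have h1 := length_iterate_split_fst (ofComplex (X i)) r
    rw [length_ofComplex_fst] at h1
    have h2 := Nat.le_mul_of_pos_left (ofComplex (X i)).2.length (pow_pos two_pos r)
    omega
  have hsize : (X i).n₀ + (X i).n₁ + (X i).n₂ ≤
      (1 + k + k * k) * (split^[r] (ofComplex (X i))).1.length := by
    have h1 := card_le_mul_of_hammingNorm (X i).bd₁ (hdeg i).1.2.1 (hdeg i).2.1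
    have h2 := card_le_mul_of_hammingNorm (X i).bd₂ (hdeg i).1.2.2.2 (hdeg i).2.2.2.1
    have h3 := Nat.mul_le_mul_left k h1
    have h4 := Nat.mul_le_mul_left (1 + k + k * k) hn
    linarith
  have hc' : c ≤ P'.eval (split^[r] (ofComplex (X i))).1.length := by
    refine hc.trans ((P.eval_nat_mono hsize).trans_eq ?_)
    simp [P']
  have hd' := hd.trans (Q.eval_nat_mono
    ((congrArg BinData.size (F2Complex.code_toLists (X i))).le.trans (hr.size_le.trans hc')))
  simp only [Polynomial.eval_add, Polynomial.eval_comp, Polynomial.eval_one]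
  change c + d + 1 ≤ P'.eval (split^[r] (ofComplex (X i))).1.length +
    Q.eval (P'.eval (split^[r] (ofComplex (X i))).1.length) + 1
  omega

namespace F2Complex

open ListXor

variable {X : F2Complex}

theorem card_xorInstance_T_le {k : ℕ} (hH : Nontrivial X.Cohomology) (hX : X.MaxDegreeLE k) :
    (X.xorInstance k).IsMaxXor 3 := by
  intro l
  refine (card_toXor_T (WellFormed.iterate_split (wellFormed_ofComplex hH) k) l).trans_le
    (count_iterate_split_le ?_ _ (List.getElem_mem l.2))
  intro c hc
  obtain ⟨y, rfl⟩ := exists_of_mem_ofComplex hH hc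
  rw [count_ofFn_decide]
  exact (hX.2.1 y).trans (Nat.le_add_left k 3)

theorem le_card_xorInstance_T {d r : ℕ} (hd : d ≤ 3) (hH : Nontrivial X.Cohomology)
    (hX : X.MinDegreeGE d) (l : Fin (X.xorInstance r).m) : d ≤ ((X.xorInstance r).T l).card := by
  refine (le_count_iterate_split hd ?_ r _ (List.getElem_mem l.2)).trans_eq
    (card_toXor_T (WellFormed.iterate_split (wellFormed_ofComplex hH) r) l).symm
  intro c hc
  obtain ⟨y, rfl⟩ := exists_of_mem_ofComplex hH hc
  rw [count_ofFn_decide]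
  exact hX.2.1 y

theorem xorInstance_m (hH : Nontrivial X.Cohomology) (r : ℕ) :
    (X.xorInstance r).m = 2 ^ r * X.n₁ :=
  (length_iterate_split_snd _ r).trans (by rw [length_ofComplex_snd hH])

theorem xorInstance_n_add (hH : Nontrivial X.Cohomology) (r : ℕ) :
    (X.xorInstance r).n + X.n₁ = X.n₀ + 2 ^ r * X.n₁ := by
  have h := length_iterate_split_fst (ofComplex X) r
  rwa [length_ofComplex_snd hH, length_ofComplex_fst] at h

theorem n₁_pos (hH : Nontrivial X.Cohomology) : 0 < X.n₁ := by
  by_contra h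
  have h0 : X.n₁ = 0 := by omega
  refine (rhs_spec hH).2.2 ?_
  have : vec X.n₁ (rhs X) = 0 := by
    ext i
    exact absurd i.2 (by omega)
  rw [this]
  exact zero_mem _

theorem xorInstance_atMostSatisfiable {μ : ℝ} (hH : Nontrivial X.Cohomology)
    (hμ : X.HasCosystolicDistance μ) (r : ℕ) :
    (X.xorInstance r).AtMostSatisfiable (1 - μ / 2 ^ r) := by
  intro f
  let f' : ℕ → ZMod 2 := fun i => if h : i < (X.xorInstance r).n then f ⟨i, h⟩ else 0
  have hf : f = fun j : Fin (X.xorInstance r).n => f' j := by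
    ext j
    simp [f']
  have h1 := numSat_toXor_add (WellFormed.iterate_split (wellFormed_ofComplex hH) r) f'
  have h2 := numUnsat_le_iterate_split (ofComplex X) f' r
  have h3 := lt_numUnsat_ofComplex hH hμ f'
  change (X.xorInstance r).numSat _ + _ = (X.xorInstance r).m at h1
  have h4 : ((X.xorInstance r).numSat f : ℝ) + (numUnsat (split^[r] (ofComplex X)) f' : ℝ) =
      (X.xorInstance r).m := by
    rw [hf]
    exact_mod_cast h1
  have h5 : ((ofComplex X).numUnsat f' : ℝ) ≤ numUnsat (split^[r] (ofComplex X)) f' := by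
    exact_mod_cast h2
  have h6 : ((X.xorInstance r).m : ℝ) = 2 ^ r * X.n₁ := by
    exact_mod_cast xorInstance_m hH r
  have h7 : μ / 2 ^ r * ((X.xorInstance r).m : ℝ) = μ * X.n₁ := by
    rw [h6]
    field_simp
  rw [sub_mul, h7]
  linarith

theorem xorInstance_notRefuted {ρ₁ ρ₂ : ℝ} (hH : Nontrivial X.Cohomology)
    (hnd : X.Nondegenerate) (hX : X.SmallSetBoundaryExpander ρ₁ ρ₂) (hρ₂ : ρ₂ ∈ Set.Ioo (0 : ℝ) 1)
    (r t : ℕ) (ht : 4 * 2 ^ r * (t : ℝ) ≤ ρ₁ * ρ₂ * X.n₁) : (X.xorInstance r).NotRefuted t := by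
  intro hI
  have hm : 0 < (X.xorInstance r).m := by
    rw [xorInstance_m hH]
    exact Nat.mul_pos (pow_pos two_pos r) (n₁_pos hH)
  have ht₁ : (1 : ℝ) ≤ t := by
    exact_mod_cast (le_card_xorInstance_T (by norm_num) hH hnd ⟨0, hm⟩).trans (hI ⟨0, hm⟩)
  have hr : (1 : ℝ) ≤ 2 ^ r := one_le_pow₀ one_le_two
  have hw₁ : 1 ≤ ρ₁ * X.n₁ / 2 := by
    have h1 : 1 ≤ 2 ^ r * (t : ℝ) := one_le_mul_of_one_le_of_one_le hr ht₁
    obtain ⟨h2, h3⟩ := hρ₂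
    by_contra! h4
    nlinarith
  obtain ⟨g, hg, hgP⟩ := exists_substitution_iterate_split (wellFormed_ofComplex hH)
    (basisVec X.n₀) (hammingNorm_basisVec_le X.n₀) (X.Derives (vec X.n₁ (rhs X)) 1)
    ⟨0, by simp, by simp, by simp⟩ (derives_ofComplex hH) r
  refine XorInstance.notRefuted_of_derives (rhs_spec hH).2.1 hX hρ₂.1 hw₁ (by linarith)
    (X.xorInstance r) hm (fun j => g j) (fun j => hg j) ?_ ?_ hI
  · push_cast
    linarith
  · intro l
    have h := hgP _ (List.getElem_mem l.2)
    have hsum : ∑ j ∈ (X.xorInstance r).T l, g j = _ :=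
      sum_toXor_T (WellFormed.iterate_split (wellFormed_ofComplex hH) r) l g
    rw [hsum]
    exact h

end F2Complex

theorem theorem6p1 (k : ℕ) (μ ρ₁ ρ₂ : ℝ) (hμ : μ ∈ Set.Ioo (0 : ℝ) 1)
    (hρ₁ : ρ₁ ∈ Set.Ioo (0 : ℝ) 1) (hρ₂ : ρ₂ ∈ Set.Ioo (0 : ℝ) 1) :
    ∃ μ₁ ∈ Set.Ioo (0 : ℝ) 1, ∃ μ₂ ∈ Set.Ioo (0 : ℝ) 1, ∃ C : ℕ,
      ∀ X : ℕ → F2Complex, ExplicitComplexes X →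
        (∀ i, (X i).Nondegenerate ∧ (X i).MaxDegreeLE k ∧ Nontrivial (X i).Cohomology ∧
          (X i).HasCosystolicDistance μ ∧ (X i).SmallSetBoundaryExpander ρ₁ ρ₂) →
        ∃ I : ℕ → XorInstance, ExplicitInstances I ∧
          ∀ i, (I i).IsMaxXor 3 ∧
            (X i).n₀ ≤ (I i).n ∧ (I i).n ≤ C * (X i).n₀ ∧
            (I i).AtMostSatisfiable (1 - μ₁) ∧
            (∀ t : ℕ, (t : ℝ) ≤ μ₂ * ((I i).n : ℝ) → (I i).NotRefuted t) ∧
            ((X i).MinDegreeGE 3 → (I i).IsExactXor 3) := by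
  have h2k : (1 : ℝ) ≤ 2 ^ k := one_le_pow₀ one_le_two
  let E : ℝ := 4 * 2 ^ k * ((1 + 2 ^ k * k) * (k + 1))
  have hE : 1 ≤ E := by
    have h1 : (1 : ℝ) ≤ (1 + 2 ^ k * k) * (k + 1) :=
      one_le_mul_of_one_le_of_one_le (by linarith [show (0 : ℝ) ≤ 2 ^ k * k by positivity])
        (by linarith [Nat.cast_nonneg (α := ℝ) k])
    exact one_le_mul_of_one_le_of_one_le (by linarith) h1
  have hρ : ρ₁ * ρ₂ ∈ Set.Ioo (0 : ℝ) 1 :=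
    ⟨mul_pos hρ₁.1 hρ₂.1, mul_lt_one_of_nonneg_of_lt_one_left hρ₁.1.le hρ₁.2 hρ₂.2.le⟩
  refine ⟨μ / 2 ^ k, ⟨div_pos hμ.1 (by positivity), (div_le_self hμ.1.le h2k).trans_lt hμ.2⟩,
    ρ₁ * ρ₂ / E, ⟨div_pos hρ.1 (by linarith), (div_le_self hρ.1.le hE).trans_lt hρ.2⟩,
    1 + 2 ^ k * k, fun X hX hprop => ⟨fun i => (X i).xorInstance k, ?_, fun i => ?_⟩⟩
  · exact explicitInstances_xorInstance k hX (fun i => ⟨(hprop i).1, (hprop i).2.1⟩)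
      fun i => (hprop i).2.2.1
  · obtain ⟨hnd, hdeg, hH, hcos, hexp⟩ := hprop i
    have hn := F2Complex.xorInstance_n_add hH k
    have h₁₀ := card_le_mul_of_hammingNorm (X i).bd₁ hnd.2.1 hdeg.1
    have h₀₁ := card_le_mul_of_hammingNorm (X i).bd₁.transpose hnd.1 hdeg.2.1
    have hle : ((X i).xorInstance k).n ≤ (1 + 2 ^ k * k) * (X i).n₀ := by
      have := Nat.mul_le_mul_left (2 ^ k) h₁₀
      rw [add_mul, one_mul, mul_assoc]
      omega
    refine ⟨F2Complex.card_xorInstance_T_le hH hdeg, ?_, hle,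
      F2Complex.xorInstance_atMostSatisfiable hH hcos k, ?_, ?_⟩
    · have := Nat.le_mul_of_pos_left (X i).n₁ (pow_pos two_pos k)
      change (X i).n₀ ≤ ((X i).xorInstance k).n
      omega
    · intro t ht
      refine F2Complex.xorInstance_notRefuted hH hnd hexp hρ₂ k t ?_
      have h1 : (((X i).xorInstance k).n : ℝ) ≤ (1 + 2 ^ k * k) * ((k + 1) * (X i).n₁) := by
        have h2 : (X i).n₀ ≤ (k + 1) * (X i).n₁ := h₀₁.trans (Nat.mul_le_mul_right _ (by omega))
        exact_mod_cast hle.trans (Nat.mul_le_mul_left _ h2)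
      have hE0 : 0 < E := by linarith
      calc 4 * 2 ^ k * (t : ℝ) ≤ 4 * 2 ^ k * (ρ₁ * ρ₂ / E *
            ((1 + 2 ^ k * k) * ((k + 1) * (X i).n₁))) := by
            gcongr
            refine ht.trans (mul_le_mul_of_nonneg_left h1 ?_)
            exact (div_pos hρ.1 hE0).le
        _ = ρ₁ * ρ₂ / E * E * (X i).n₁ := by simp only [E]; ring
        _ = ρ₁ * ρ₂ * (X i).n₁ := by rw [div_mul_cancel₀ _ hE0.ne']
    · intro h3 l
      exact le_antisymm (F2Complex.card_xorInstance_T_le hH hdeg l)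
        (F2Complex.le_card_xorInstance_T le_rfl hH h3 l)
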